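/- Let $d\in\mathbb N$ and let $H:\mathbb R^d\times\mathbb R^{d*}\to\mathbb R$, $(q,p)\mapsto H(q,p)$, be a $C^2$ (autonomous) Hamiltonian for which there are constants $m>0$ and $M$ such that $\|d^2H\|\le M$ and $\partial^2_{pp}H\ge m\,\mathrm{Id}$ everywhere, and $\frac m2|p|^2-M\le H(q,p)\le\frac M2|p|^2+M$ for all $(q,p)$. Assume that $H$ is periodic: $H(q+w,p)=H(q,p)$ for all $w\in\mathbb Z^d$. Let $\varphi^t=(Q^t,P^t)$, $t\in\mathbb R$, be the flow of $\dot q=\partial_pH(q,p)$, $\dot p=-\partial_qH(q,p)$. For $t>0$ small (a twist time: for each $s\in\,]0,t]$ and each $q$, the map $p\mapsto Q^s(q,p)$ is a bijection of $\mathbb R^{d*}$ onto $\mathbb R^d$) let $S^t(q_0,q_1)=\int_0^t \big(p(s)\cdot\dot q(s)-H(q(s),p(s))\big)\,ds$ be the action of the unique orbit $(q(s),p(s))$ with $q(0)=q_0$ and $q(t)=q_1$. For $t>0$ let $A^t(q_0,q_1)$ be the infimum over $\theta_1,\dots,\theta_{n-1}\in\mathbb R^d$ of $S^{t/n}(q_0,\theta_1)+S^{t/n}(\theta_1,\theta_2)+\cdots+S^{t/n}(\theta_{n-1},q_1)$,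 where $n\geq 1$ is any integer such that $t/n$ is a twist time (the value does not depend on $n$). For $u:\mathbb R^d\to\mathbb R$ let $\mathbf T^tu(q)=\inf_{\theta\in\mathbb R^d}\big(u(\theta)+A^t(\theta,q)\big)$ for $t>0$, and $\mathbf T^0u=u$. The function $u$ is called a weak KAM solution at level $a\in\mathbb R$ if $\mathbf T^tu+ta=u$ for each $t\ge0$, and a weak KAM solution if this holds for some $a$; it is called periodic if $u(q+w)=u(q)$ for all $q\in\mathbb R^d$, $w\in\mathbb Z^d$. Let $\Gamma_u=\{(q,du(q)) : u \text{ is differentiable at } q\}$ and $\mathcal I^*(u)=\bigcap_{n\in\mathbb N}\varphi^{-n}(\overline{\Gamma_u})$. Then there exists a periodic weak KAM solution. Moreover, for each periodic weak KAM solution $u$, the set $\mathcal I^*(u)$ is non-empty and closed, it is invariant ($\varphi^t(\mathcal I^*(u))=\mathcal I^*(u)$ for each $t\in\mathbb R$), it is invariant under the translations $(q,p)\mapsto(q+w,p)$, $w\in\mathbb Z^d$, and it is contained in the graph of a Lipschitz map $\mathbb R^d\to\mathbb R^{d*}$. -/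

import Mathlib

open scoped RealInnerProductSpace

namespace WeakKAM

/-- The configuration space `ℝ^d` with its Euclidean norm. The momentum space `ℝ^{d*}` is identified
with it, isometrically, through the Euclidean inner product. -/
abbrev Conf (d : ℕ) : Type := EuclideanSpace ℝ (Fin d)

/-- The phase space `ℝ^d × ℝ^{d*}`; a point is `x = (q, p)`. -/
abbrev Phase (d : ℕ) : Type := Conf d × Conf d

/-- The integer vector `w`, as an element of `ℝ^d`. -/
noncomputable def intVec {d : ℕ} (w : Fin d → ℤ) : Conf d :=
  WithLp.toLp 2 (fun i => (w i : ℝ))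

/-- The translation `(q, p) ↦ (q + w, p)` of the phase space. -/
noncomputable def phaseTranslate {d : ℕ} (w : Fin d → ℤ) (x : Phase d) : Phase d :=
  (x.1 + intVec w, x.2)

/-- The standing hypotheses on an autonomous Hamiltonian `H(q, p)` of class `C²`:
the second differential is bounded, `∂²_{pp} H ≥ m Id` as quadratic forms, and
`m/2 |p|² - M ≤ H(q, p) ≤ M/2 |p|² + M`. -/
structure Hypotheses {d : ℕ} (H : Phase d → ℝ) (m M : ℝ) : Prop where
  contDiff : ContDiff ℝ 2 H
  norm_d2_le : ∀ x, ‖fderiv ℝ (fderiv ℝ H) x‖ ≤ M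
  m_pos : 0 < m
  convex : ∀ (x : Phase d) (ξ : Conf d),
    m * ‖ξ‖ ^ 2 ≤ fderiv ℝ (fderiv ℝ H) x (0, ξ) (0, ξ)
  lower : ∀ q p : Conf d, m / 2 * ‖p‖ ^ 2 - M ≤ H (q, p)
  upper : ∀ q p : Conf d, H (q, p) ≤ M / 2 * ‖p‖ ^ 2 + M

/-- `H(q + w, p) = H(q, p)` for each `w ∈ ℤ^d`. -/
def PeriodicHamiltonian {d : ℕ} (H : Phase d → ℝ) : Prop :=
  ∀ (w : Fin d → ℤ) (q p : Conf d), H (q + intVec w, p) = H (q, p)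

/-- `u(q + w) = u(q)` for each `w ∈ ℤ^d`. -/
def PeriodicFunction {d : ℕ} (u : Conf d → ℝ) : Prop :=
  ∀ (w : Fin d → ℤ) (q : Conf d), u (q + intVec w) = u q

/-- The Hamiltonian vector field `X_H = (∂_p H, -∂_q H)`. -/
noncomputable def hamVectorField {d : ℕ} (H : Phase d → ℝ) (x : Phase d) : Phase d :=
  (gradient (fun p => H (x.1, p)) x.2, -gradient (fun q => H (q, x.2)) x.1)

/-- `γ` is a (complete) orbit of the Hamiltonian system `ẋ = X_H(x)`. -/
def IsOrbit {d : ℕ} (H : Phase d → ℝ) (γ : ℝ → Phase d) : Prop :=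
  ∀ t, HasDerivAt γ (hamVectorField H (γ t)) t

open Classical in
/-- The Hamiltonian flow `φ^t`: the value at time `t` of the orbit which is at `x` at time `0`.
If the second differential of `H` is bounded then `X_H` is Lipschitz, and this orbit exists and
is unique, so that the second branch is not used. -/
noncomputable def flow {d : ℕ} (H : Phase d → ℝ) (t : ℝ) (x : Phase d) : Phase d :=
  if h : ∃ γ, IsOrbit H γ ∧ γ 0 = x then h.choose t else x

/-- The Hamiltonian action `∫_0^t p(s) · q̇(s) - H(q(s), p(s)) ds` of a curve `γ = (q, p)`. -/
noncomputable def hamAction {d : ℕ} (H : Phase d → ℝ) (t : ℝ) (γ : ℝ → Phase d) : ℝ :=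
  ∫ s in (0 : ℝ)..t, (⟪(γ s).2, deriv (fun r => (γ r).1) s⟫ - H (γ s))

/-- Every time `s ∈ ]0, τ]` has the twist property: for each `q`, the map `p ↦ Q^s(q, p)` is
a bijection of `ℝ^d`. In other words any two points are joined, in time `s`, by exactly one orbit. -/
def IsTwistTime {d : ℕ} (H : Phase d → ℝ) (τ : ℝ) : Prop :=
  ∀ s, 0 < s → s ≤ τ → ∀ q : Conf d, Function.Bijective (fun p : Conf d => (flow H s (q, p)).1)

/-- `ρ₀(t, q₀, q₁)`: the momentum `p` such that `Q^t(q₀, p) = q₁` (for a twist time `t`). -/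
noncomputable def initialMomentum {d : ℕ} (H : Phase d → ℝ) (t : ℝ) (q₀ q₁ : Conf d) : Conf d :=
  Function.invFun (fun p : Conf d => (flow H t (q₀, p)).1) q₁

/-- The generating function `S^t(q₀, q₁)`: the action of the unique orbit joining `q₀` to `q₁` in
time `t` (for a twist time `t`). -/
noncomputable def genFun {d : ℕ} (H : Phase d → ℝ) (t : ℝ) (q₀ q₁ : Conf d) : ℝ :=
  hamAction H t (fun s => flow H s (q₀, initialMomentum H t q₀ q₁))

/-- The minimal action `A^t(q₀, q₁)`, `t > 0`: the infimum of
`S^{t/n}(q₀, θ₁) + S^{t/n}(θ₁, θ₂) + ⋯ + S^{t/n}(θ_{n-1}, q₁)` over `θ₁, …, θ_{n-1}`, where `n` is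
any positive integer such that `t/n` is a twist time. It is taken in the extended reals, so that no
finiteness is presupposed. (The infimum over the `θ_i` is the same for all such `n`, because an orbit
on a time interval can be cut into orbits on shorter intervals and, on twist times, orbits minimize;
hence taking also the infimum over `n` is harmless.) -/
noncomputable def minAction {d : ℕ} (H : Phase d → ℝ) (t : ℝ) (q₀ q₁ : Conf d) : EReal :=
  ⨅ (n : ℕ) (_ : 0 < n) (_ : IsTwistTime H (t / n))
    (θ : ℕ → Conf d) (_ : θ 0 = q₀) (_ : θ n = q₁),
      ((∑ i ∈ Finset.range n, genFun H (t / n) (θ i) (θ (i + 1)) : ℝ) : EReal)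

open Classical in
/-- The Lax-Oleinik operators `T^t u(q) = inf_θ (u(θ) + A^t(θ, q))` for `t > 0`, and `T^0 u = u`. -/
noncomputable def laxOleinik {d : ℕ} (H : Phase d → ℝ) (t : ℝ) (u : Conf d → ℝ) (q : Conf d) :
    EReal :=
  if t = 0 then (u q : EReal) else ⨅ θ : Conf d, ((u θ : EReal) + minAction H t θ q)

/-- `u` is a Weak KAM solution at level `a`: `T^t u + t a = u` for each `t ≥ 0`. -/
def IsWeakKAM {d : ℕ} (H : Phase d → ℝ) (a : ℝ) (u : Conf d → ℝ) : Prop :=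
  ∀ t : ℝ, 0 ≤ t → ∀ q : Conf d, laxOleinik H t u q + ((t * a : ℝ) : EReal) = (u q : EReal)

/-- `Γ_u`: the graph of the differential of `u` on the set of points of differentiability. -/
def diffGraph {d : ℕ} (u : Conf d → ℝ) : Set (Phase d) :=
  {x | DifferentiableAt ℝ u x.1 ∧ x.2 = gradient u x.1}

/-- `I*(u) = ⋂_{n ∈ ℕ} φ^{-n}(closure Γ_u)`. -/
def invSet {d : ℕ} (H : Phase d → ℝ) (u : Conf d → ℝ) : Set (Phase d) :=
  ⋂ n : ℕ, flow H (-(n : ℝ)) '' closure (diffGraph u)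

end WeakKAM

/-! Actions are bounded below by calibration. Around a reference orbit take the affine function
whose slope is the momentum, minus a parabola whose coefficient grows with time (`compPot`). For
short times, Fenchel's inequality shows that its increment along any other orbit is at most the
difference of the actions; summing over pieces gives `chain_compare`, valid for broken orbits too.
Hence short orbits minimize (`genFun_le_chain`), and the generating function has quadratic upper
bounds in each end point, with slopes given by the end momenta (`exists_genFun_semiconcave`).

Let `u` be a periodic weak KAM solution. For a short time the infimum defining it is attained. The
final momentum of a minimizing orbit is a superdifferential of `u` at its end, the initial momentum
a subdifferential at its start. Where `u` is differentiable the final momentum is `du`, so orbits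
ending in `Γ_u` are calibrated in the past, and by continuity so are those ending in its closure
(`calibrated`). If `x` lies in the closure, the position of `φ^{-t} x` is the start of one
minimizing orbit and the end of another; a sub- and a superdifferential then coexist, so they agree
and `u` is differentiable there (`exists_isSuperDiff_isSubDiff`). Thus `φ^{-t}` maps the closure
into `Γ_u`, the sets in the definition of `I*(u)` are nested, and compactness modulo `ℤ^d` gives
non-emptiness. The two-sided quadratic bounds have a uniform constant, which yields the Lipschitz
graph (`norm_sub_le_of_isSuperDiff_isSubDiff`).

For existence, start from the zero function. Its evolution `minCost` has oscillation bounded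
uniformly in time, so its value at `0` is additive in time up to a constant. A Fekete argument
(`exists_slope_of_quasi_additive`) produces the level `a`, and the lower limit of `minCost H t + t *
a` as `t → ∞` is a weak KAM solution. -/

/-! ### Global integral curves of a `C¹` Lipschitz vector field. -/

theorem exists_global_integralCurve {E : Type*} [NormedAddCommGroup E] [NormedSpace ℝ E]
    [CompleteSpace E] {v : E → E} {K : NNReal} (hv : LipschitzWith K v) (hv1 : ContDiff ℝ 1 v)
    (x : E) : ∃ γ : ℝ → E, γ 0 = x ∧ ∀ t, HasDerivAt γ (v (γ t)) t := by
  have key : ∃ γ : ℝ → E, γ 0 = x ∧ IsMIntegralCurve (I := modelWithCornersSelf ℝ E) γ v := by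
    have hcm : ContMDiff (modelWithCornersSelf ℝ E) (modelWithCornersSelf ℝ E).tangent 1
        (fun x ↦ (⟨x, v x⟩ : TangentBundle (modelWithCornersSelf ℝ E) E)) :=
      contMDiff_vectorSpace_iff_contDiff.2 hv1
    have hε : (0 : ℝ) < 1 / (1 + K) := by positivity
    refine exists_isMIntegralCurve_of_isMIntegralCurveOn hcm hε (fun y => ?_) x
    -- On the ball of radius `‖v y‖ + 1` the field is at most `‖v y‖ + K(‖v y‖ + 1)`, so solutions
    -- stay inside for time `1/(1+K)`. This time does not depend on `y`, which is what lets local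
    -- solutions be continued for ever.
    have hPL : IsPicardLindelof (fun _ : ℝ => v) (tmin := -(1 / (1 + K))) (tmax := 1 / (1 + K))
        ⟨0, by constructor <;> linarith⟩ y (‖v y‖₊ + 1) 0 (‖v y‖₊ + K * (‖v y‖₊ + 1)) K := by
      apply IsPicardLindelof.of_time_independent
      · intro z hz
        have h1 := hv.dist_le_mul z y
        have h2 : ‖v z‖ ≤ ‖v y‖ + dist (v z) (v y) := by
          rw [dist_eq_norm]; simpa using norm_add_le (v y) (v z - v y)
        have h3 : dist z y ≤ ‖v y‖ + 1 := by simpa using hz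
        have h4 : (K : ℝ) * dist z y ≤ K * (‖v y‖ + 1) := by gcongr
        push_cast
        linarith
      · exact hv.lipschitzOnWith
      · simp only [sub_zero, zero_sub, neg_neg, max_self]
        push_cast
        simp only [sub_zero]
        rw [mul_one_div, div_le_iff₀ (by positivity)]
        nlinarith [norm_nonneg (v y), K.2]
    obtain ⟨α, h0, hα⟩ := hPL.exists_eq_forall_mem_Icc_hasDerivWithinAt₀
    refine ⟨α, h0, fun t ht => ?_⟩
    exact hasMFDerivWithinAt_iff_hasFDerivWithinAt.2
      ((hα t ⟨ht.1.le, ht.2.le⟩).mono Set.Ioo_subset_Icc_self).hasFDerivWithinAt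
  obtain ⟨γ, h0, hγ⟩ := key
  refine ⟨γ, h0, fun t => ?_⟩
  have h : HasFDerivAt γ ((1 : ℝ →L[ℝ] ℝ).smulRight (v (γ t))) t :=
    hasMFDerivAt_iff_hasFDerivAt.1 (hγ t)
  simpa using h.hasDerivAt

/-! ### First- and second-order estimates on the Hamiltonian. -/

namespace WeakKAM

variable {d : ℕ} {H : Phase d → ℝ} {m M : ℝ}

/-- The Lagrangian `p · ∂_p H - H`, as a function on the phase space. -/
noncomputable def lag (H : Phase d → ℝ) (x : Phase d) : ℝ :=
  ⟪x.2, (hamVectorField H x).1⟫ - H x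

theorem Hypotheses.nonneg (hH : Hypotheses H m M) : 0 ≤ M :=
  (norm_nonneg (fderiv ℝ (fderiv ℝ H) 0)).trans (hH.norm_d2_le 0)

theorem Hypotheses.differentiable (hH : Hypotheses H m M) : Differentiable ℝ H :=
  hH.contDiff.differentiable (by norm_num)

theorem Hypotheses.contDiff_fderiv (hH : Hypotheses H m M) : ContDiff ℝ 1 (fderiv ℝ H) :=
  hH.contDiff.fderiv_right (by norm_num)

theorem Hypotheses.norm_fderiv_sub_le (hH : Hypotheses H m M) (x y : Phase d) :
    ‖fderiv ℝ H x - fderiv ℝ H y‖ ≤ M * ‖x - y‖ :=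
  Convex.norm_image_sub_le_of_norm_fderiv_le (s := Set.univ)
    (fun z _ => hH.contDiff_fderiv.differentiable (by norm_num) z) (fun z _ => hH.norm_d2_le z)
    convex_univ trivial trivial

theorem hamVectorField_eq (hd : Differentiable ℝ H) :
    hamVectorField H = fun x =>
      ((InnerProductSpace.toDual ℝ (Conf d)).symm
          ((fderiv ℝ H x).comp (ContinuousLinearMap.inr ℝ (Conf d) (Conf d))),
        -(InnerProductSpace.toDual ℝ (Conf d)).symm
          ((fderiv ℝ H x).comp (ContinuousLinearMap.inl ℝ (Conf d) (Conf d)))) := by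
  funext x
  have h1 : HasFDerivAt (fun p => H (x.1, p))
      ((fderiv ℝ H x).comp (ContinuousLinearMap.inr ℝ (Conf d) (Conf d))) x.2 :=
    HasFDerivAt.comp (g := H) (f := fun p => (x.1, p)) x.2 (hd x).hasFDerivAt
      (hasFDerivAt_prodMk_right x.1 x.2)
  have h2 : HasFDerivAt (fun q => H (q, x.2))
      ((fderiv ℝ H x).comp (ContinuousLinearMap.inl ℝ (Conf d) (Conf d))) x.1 :=
    HasFDerivAt.comp (g := H) (f := fun q => (q, x.2)) x.1 (hd x).hasFDerivAt
      (hasFDerivAt_prodMk_left x.1 x.2)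
  simp only [hamVectorField, gradient, h1.fderiv, h2.fderiv]

theorem fderiv_eq_inner (hd : Differentiable ℝ H) (x v : Phase d) :
    fderiv ℝ H x v = ⟪(hamVectorField H x).1, v.2⟫ - ⟪(hamVectorField H x).2, v.1⟫ := by
  rw [hamVectorField_eq hd]
  simp only [inner_neg_left, InnerProductSpace.toDual_symm_apply, ContinuousLinearMap.comp_apply,
    ContinuousLinearMap.inr_apply, ContinuousLinearMap.inl_apply, sub_neg_eq_add, ← map_add]
  simp

theorem Hypotheses.contDiff_hamVectorField (hH : Hypotheses H m M) :
    ContDiff ℝ 1 (hamVectorField H) := by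
  rw [hamVectorField_eq hH.differentiable]
  have h := hH.contDiff_fderiv
  exact ((LinearIsometryEquiv.contDiff _).comp (h.clm_comp contDiff_const)).prodMk
    ((LinearIsometryEquiv.contDiff _).comp (h.clm_comp contDiff_const)).neg

theorem Hypotheses.norm_hamVectorField_sub_le (hH : Hypotheses H m M) (x y : Phase d) :
    ‖hamVectorField H x - hamVectorField H y‖ ≤ M * ‖x - y‖ := by
  refine le_trans ?_ (hH.norm_fderiv_sub_le x y)
  rw [hamVectorField_eq hH.differentiable]
  refine max_le ?_ ?_
  · simp only [Prod.fst_sub, ← map_sub, LinearIsometryEquiv.norm_map,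
      ← ContinuousLinearMap.sub_comp]
    refine (ContinuousLinearMap.opNorm_comp_le _ _).trans ?_
    exact mul_le_of_le_one_right (norm_nonneg _) (ContinuousLinearMap.norm_inr_le_one ℝ _ _)
  · simp only [Prod.snd_sub, neg_sub_neg, ← map_sub, LinearIsometryEquiv.norm_map,
      ← ContinuousLinearMap.sub_comp]
    rw [norm_sub_rev (fderiv ℝ H x)]
    refine (ContinuousLinearMap.opNorm_comp_le _ _).trans ?_
    exact mul_le_of_le_one_right (norm_nonneg _) (ContinuousLinearMap.norm_inl_le_one ℝ _ _)

theorem Hypotheses.lipschitz (hH : Hypotheses H m M) :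
    LipschitzWith M.toNNReal (hamVectorField H) :=
  LipschitzWith.of_dist_le_mul fun x y => by
    rw [dist_eq_norm, dist_eq_norm, Real.coe_toNNReal _ hH.nonneg]
    exact hH.norm_hamVectorField_sub_le x y

theorem norm_sq_prod_le (v : Phase d) : ‖v‖ ^ 2 ≤ ‖v.1‖ ^ 2 + ‖v.2‖ ^ 2 := by
  rw [Prod.norm_def]
  rcases max_choice ‖v.1‖ ‖v.2‖ with h | h <;> rw [h] <;> nlinarith [sq_nonneg ‖v.1‖, sq_nonneg ‖v.2‖]

theorem exists_slope (hd : Differentiable ℝ H) (x v : Phase d) :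
    ∃ c ∈ Set.Ioo (0 : ℝ) 1, H (x + v) - H x = fderiv ℝ H (x + c • v) v := by
  have hder : ∀ t : ℝ, HasDerivAt (fun t : ℝ => H (x + t • v)) (fderiv ℝ H (x + t • v) v) t := by
    intro t
    have h1 : HasDerivAt (fun t : ℝ => x + t • v) v t := by
      simpa using ((hasDerivAt_id t).smul_const v).const_add x
    exact (hd (x + t • v)).hasFDerivAt.comp_hasDerivAt t h1
  obtain ⟨c, hc, h⟩ := exists_hasDerivAt_eq_slope (fun t : ℝ => H (x + t • v)) _ zero_lt_one
    (fun t _ => (hder t).continuousAt.continuousWithinAt) (fun t _ => hder t)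
  refine ⟨c, hc, ?_⟩
  rw [h]
  simp

theorem Hypotheses.taylor_le (hH : Hypotheses H m M) (x y : Phase d) :
    H y ≤ H x + ⟪(hamVectorField H x).1, y.2 - x.2⟫ - ⟪(hamVectorField H x).2, y.1 - x.1⟫
      + M * (‖y.1 - x.1‖ ^ 2 + ‖y.2 - x.2‖ ^ 2) := by
  obtain ⟨c, hc, h⟩ := exists_slope hH.differentiable x (y - x)
  have h1 := fderiv_eq_inner hH.differentiable x (y - x)
  have h2 : (fderiv ℝ H (x + c • (y - x)) - fderiv ℝ H x) (y - x) ≤ M * ‖y - x‖ ^ 2 := by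
    have h3 := hH.norm_fderiv_sub_le (x + c • (y - x)) x
    have h4 : ‖x + c • (y - x) - x‖ ≤ ‖y - x‖ := by
      rw [add_sub_cancel_left, norm_smul, Real.norm_eq_abs, abs_of_pos hc.1]
      exact mul_le_of_le_one_left (norm_nonneg _) hc.2.le
    calc _ ≤ ‖(fderiv ℝ H (x + c • (y - x)) - fderiv ℝ H x) (y - x)‖ := Real.le_norm_self _
      _ ≤ ‖fderiv ℝ H (x + c • (y - x)) - fderiv ℝ H x‖ * ‖y - x‖ :=
          ContinuousLinearMap.le_opNorm _ _
      _ ≤ (M * ‖y - x‖) * ‖y - x‖ := by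
          gcongr
          exact h3.trans (mul_le_mul_of_nonneg_left h4 hH.nonneg)
      _ = _ := by ring
  have h5 := mul_le_mul_of_nonneg_left (norm_sq_prod_le (y - x)) hH.nonneg
  rw [add_sub_cancel] at h
  simp only [sub_apply, Prod.fst_sub, Prod.snd_sub] at *
  linarith

theorem Hypotheses.monotone_momentum (hH : Hypotheses H m M) (q p ξ : Conf d) :
    m * ‖ξ‖ ^ 2 ≤ ⟪(hamVectorField H (q, p + ξ)).1 - (hamVectorField H (q, p)).1, ξ⟫ := by
  have hder : ∀ t : ℝ, HasDerivAt (fun t : ℝ => fderiv ℝ H ((q, p) + t • (0, ξ)) (0, ξ))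
      (fderiv ℝ (fderiv ℝ H) ((q, p) + t • (0, ξ)) (0, ξ) (0, ξ)) t := by
    intro t
    have h1 : HasDerivAt (fun t : ℝ => ((q, p) : Phase d) + t • ((0, ξ) : Phase d)) (0, ξ) t := by
      simpa using ((hasDerivAt_id t).smul_const ((0, ξ) : Phase d)).const_add (q, p)
    have h2 := ((hH.contDiff_fderiv.differentiable (by norm_num)
      ((q, p) + t • (0, ξ))).hasFDerivAt).comp_hasDerivAt t h1
    have h3 := h2.clm_apply (hasDerivAt_const t ((0, ξ) : Phase d))
    simpa using h3
  obtain ⟨c, -, h⟩ := exists_hasDerivAt_eq_slope _ _ zero_lt_one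
    (fun t _ => (hder t).continuousAt.continuousWithinAt) (fun t _ => hder t)
  have h4 := hH.convex ((q, p) + c • (0, ξ)) ξ
  rw [h] at h4
  simp only [fderiv_eq_inner hH.differentiable] at h4
  simpa [inner_sub_left] using h4

theorem Hypotheses.convex_momentum (hH : Hypotheses H m M) (q p ξ : Conf d) :
    H (q, p) + ⟪(hamVectorField H (q, p)).1, ξ⟫ ≤ H (q, p + ξ) := by
  obtain ⟨c, hc, h⟩ := exists_slope hH.differentiable (q, p) (0, ξ)
  have h1 := hH.monotone_momentum q p (c • ξ)
  rw [fderiv_eq_inner hH.differentiable] at h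
  simp only [Prod.smul_mk, Prod.mk_add_mk, smul_zero, add_zero, inner_zero_right, sub_zero] at h
  rw [inner_smul_right, norm_smul, Real.norm_eq_abs, abs_of_pos hc.1, inner_sub_left] at h1
  have h2 : 0 ≤ m * (c * ‖ξ‖) ^ 2 := mul_nonneg hH.m_pos.le (sq_nonneg _)
  have h4 : 0 ≤ ⟪(hamVectorField H (q, p + c • ξ)).1, ξ⟫ - ⟪(hamVectorField H (q, p)).1, ξ⟫ :=
    nonneg_of_mul_nonneg_right (h2.trans h1) hc.1
  linarith

/-- By convexity, the momentum of `x` maximizes `p ↦ p · v - H(q, p)` for the velocity `v` of `x`.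
Every lower bound on an action comes from inserting a test momentum here. -/
theorem Hypotheses.fenchel (hH : Hypotheses H m M) (x : Phase d) (p : Conf d) :
    ⟪p, (hamVectorField H x).1⟫ - H (x.1, p) ≤ lag H x := by
  have h := hH.convex_momentum x.1 x.2 (p - x.2)
  rw [add_sub_cancel, inner_sub_right, real_inner_comm, real_inner_comm x.2] at h
  unfold lag
  linarith

theorem PeriodicHamiltonian.phaseTranslate (hper : PeriodicHamiltonian H) (w : Fin d → ℤ)
    (x : Phase d) : H (phaseTranslate w x) = H x := hper w x.1 x.2

theorem hamVectorField_phaseTranslate (hper : PeriodicHamiltonian H) (w : Fin d → ℤ)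
    (x : Phase d) : hamVectorField H (phaseTranslate w x) = hamVectorField H x := by
  have h1 : (fun p => H (x.1 + intVec w, p)) = fun p => H (x.1, p) := funext fun p => hper w _ p
  have h2 : (fun q => H (q, x.2)) = fun q => H (q + intVec w, x.2) :=
    funext fun q => (hper w q _).symm
  have h3 : gradient (fun q => H (q, x.2)) (x.1 + intVec w) = gradient (fun q => H (q, x.2)) x.1 := by
    conv_rhs => rw [h2]
    simp only [gradient]
    rw [fderiv_comp_add_right (f := fun q => H (q, x.2)) (intVec w)]
  simp only [hamVectorField, WeakKAM.phaseTranslate, h1, h3]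

theorem lag_phaseTranslate (hper : PeriodicHamiltonian H) (w : Fin d → ℤ) (x : Phase d) :
    lag H (phaseTranslate w x) = lag H x := by
  simp only [lag, hamVectorField_phaseTranslate hper, hper.phaseTranslate]
  rfl

/-! ### The Hamiltonian flow. -/

theorem Hypotheses.continuous_hamVectorField (hH : Hypotheses H m M) :
    Continuous (hamVectorField H) := hH.lipschitz.continuous

theorem Hypotheses.continuous_lag (hH : Hypotheses H m M) : Continuous (lag H) :=
  (continuous_snd.inner hH.continuous_hamVectorField.fst).sub hH.contDiff.continuous

theorem Hypotheses.isOrbit_flow (hH : Hypotheses H m M) (x : Phase d) :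
    IsOrbit H (fun t => flow H t x) ∧ flow H 0 x = x := by
  have h : ∃ γ, IsOrbit H γ ∧ γ 0 = x := by
    obtain ⟨γ, h0, h1⟩ := exists_global_integralCurve hH.lipschitz hH.contDiff_hamVectorField x
    exact ⟨γ, h1, h0⟩
  simpa only [flow, dif_pos h] using h.choose_spec

theorem Hypotheses.hasDerivAt_flow (hH : Hypotheses H m M) (x : Phase d) (t : ℝ) :
    HasDerivAt (fun t => flow H t x) (hamVectorField H (flow H t x)) t :=
  (hH.isOrbit_flow x).1 t

theorem Hypotheses.flow_zero (hH : Hypotheses H m M) (x : Phase d) : flow H 0 x = x :=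
  (hH.isOrbit_flow x).2

theorem Hypotheses.eq_flow (hH : Hypotheses H m M) {γ : ℝ → Phase d} (hγ : IsOrbit H γ) (t : ℝ) :
    γ t = flow H t (γ 0) := by
  have := ODE_solution_unique_univ (v := fun _ => hamVectorField H) (s := fun _ => Set.univ)
    (t₀ := 0) (f := γ) (g := fun t => flow H t (γ 0))
    (fun _ => hH.lipschitz.lipschitzOnWith) (fun t => ⟨hγ t, trivial⟩)
    (fun t => ⟨hH.hasDerivAt_flow _ t, trivial⟩) (hH.flow_zero _).symm
  exact congrFun this t

theorem Hypotheses.flow_add (hH : Hypotheses H m M) (s t : ℝ) (x : Phase d) :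
    flow H (s + t) x = flow H t (flow H s x) := by
  have h : IsOrbit H (fun r => flow H (s + r) x) := fun r => by
    simpa using (hH.hasDerivAt_flow x (s + r)).comp_const_add s r
  simpa using hH.eq_flow h t

theorem Hypotheses.flow_neg_flow (hH : Hypotheses H m M) (t : ℝ) (x : Phase d) :
    flow H (-t) (flow H t x) = x := by
  rw [← hH.flow_add, add_neg_cancel, hH.flow_zero]

theorem Hypotheses.flow_flow_neg (hH : Hypotheses H m M) (t : ℝ) (x : Phase d) :
    flow H t (flow H (-t) x) = x := by
  rw [← hH.flow_add, neg_add_cancel, hH.flow_zero]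

theorem Hypotheses.flow_phaseTranslate (hH : Hypotheses H m M) (hper : PeriodicHamiltonian H)
    (w : Fin d → ℤ) (t : ℝ) (x : Phase d) :
    flow H t (phaseTranslate w x) = phaseTranslate w (flow H t x) := by
  have h : IsOrbit H (fun r => phaseTranslate w (flow H r x)) := fun r => by
    rw [hamVectorField_phaseTranslate hper]
    have h1 : (fun r => phaseTranslate w (flow H r x)) =
        fun r => flow H r x + ((intVec w, 0) : Phase d) := by
      funext r; simp [phaseTranslate, Prod.ext_iff]
    rw [h1]
    exact (hH.hasDerivAt_flow x r).add_const _
  simpa [hH.flow_zero] using (hH.eq_flow h t).symm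

theorem Hypotheses.dist_flow_le_of_nonneg (hH : Hypotheses H m M) {t : ℝ} (ht : 0 ≤ t)
    (x y : Phase d) : dist (flow H t x) (flow H t y) ≤ dist x y * Real.exp (M * t) := by
  have := dist_le_of_trajectories_ODE (v := fun _ => hamVectorField H) (K := M.toNNReal)
    (f := fun s => flow H s x) (g := fun s => flow H s y) (a := 0) (b := t) (δ := dist x y)
    (fun _ => hH.lipschitz) (fun s _ => (hH.hasDerivAt_flow x s).continuousAt.continuousWithinAt)
    (fun s _ => (hH.hasDerivAt_flow x s).hasDerivWithinAt)
    (fun s _ => (hH.hasDerivAt_flow y s).continuousAt.continuousWithinAt)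
    (fun s _ => (hH.hasDerivAt_flow y s).hasDerivWithinAt)
    (by simp [hH.flow_zero]) t ⟨ht, le_rfl⟩
  simpa [Real.coe_toNNReal _ hH.nonneg] using this

theorem Hypotheses.dist_flow_le (hH : Hypotheses H m M) (t : ℝ) (x y : Phase d) :
    dist (flow H t x) (flow H t y) ≤ dist x y * Real.exp (M * |t|) := by
  rcases le_total 0 t with ht | ht
  · rw [abs_of_nonneg ht]; exact hH.dist_flow_le_of_nonneg ht x y
  · have hd : ∀ (z : Phase d) (s : ℝ),
        HasDerivAt (fun s => flow H (-s) z) (-hamVectorField H (flow H (-s) z)) s := fun z s => by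
      have h := (hH.hasDerivAt_flow z (-s)).scomp s (hasDerivAt_neg s)
      rwa [neg_smul, one_smul] at h
    have := dist_le_of_trajectories_ODE (v := fun _ x => -hamVectorField H x) (K := M.toNNReal)
      (f := fun s => flow H (-s) x) (g := fun s => flow H (-s) y) (a := 0) (b := -t)
      (δ := dist x y)
      (fun _ => hH.lipschitz.neg) (fun s _ => (hd x s).continuousAt.continuousWithinAt)
      (fun s _ => (hd x s).hasDerivWithinAt)
      (fun s _ => (hd y s).continuousAt.continuousWithinAt)
      (fun s _ => (hd y s).hasDerivWithinAt)
      (by simp [hH.flow_zero]) (-t) ⟨by linarith, le_rfl⟩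
    simpa [Real.coe_toNNReal _ hH.nonneg, abs_of_nonpos ht] using this

theorem Hypotheses.continuous_flow_time (hH : Hypotheses H m M) (x : Phase d) :
    Continuous fun t => flow H t x :=
  continuous_iff_continuousAt.2 fun t => (hH.hasDerivAt_flow x t).continuousAt

theorem Hypotheses.continuous_flow (hH : Hypotheses H m M) :
    Continuous fun z : ℝ × Phase d => flow H z.1 z.2 := by
  refine continuous_iff_continuousAt.2 fun z₀ => ?_
  rw [ContinuousAt, tendsto_iff_dist_tendsto_zero]
  have h1 : Continuous fun z : ℝ × Phase d => dist z.2 z₀.2 * Real.exp (M * |z.1|)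
      + dist (flow H z.1 z₀.2) (flow H z₀.1 z₀.2) :=
    ((continuous_snd.dist continuous_const).mul (by fun_prop)).add
      (((hH.continuous_flow_time z₀.2).comp continuous_fst).dist continuous_const)
  have h2 := h1.tendsto z₀
  simp only [dist_self, zero_mul, add_zero] at h2
  refine squeeze_zero (fun _ => dist_nonneg) (fun z => ?_) h2
  exact (dist_triangle _ (flow H z.1 z₀.2) _).trans
    (add_le_add_left (hH.dist_flow_le _ _ _) _)

theorem Hypotheses.continuous_flow_map (hH : Hypotheses H m M) (t : ℝ) :
    Continuous (flow H t) :=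
  hH.continuous_flow.comp (continuous_const.prodMk continuous_id)

end WeakKAM

/-! ### Two analytic tools. -/

theorem le_of_hasDerivAt_nonneg {f f' : ℝ → ℝ} {t : ℝ} (ht : 0 ≤ t)
    (hf : ∀ r ∈ Set.Icc 0 t, HasDerivAt f (f' r) r) (hf' : ∀ r ∈ Set.Icc 0 t, 0 ≤ f' r) :
    f 0 ≤ f t := by
  rcases ht.eq_or_lt with rfl | ht
  · exact le_rfl
  obtain ⟨c, hc, h⟩ := exists_hasDerivAt_eq_slope f f' ht
    (fun r hr => (hf r hr).continuousAt.continuousWithinAt)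
    (fun r hr => hf r ⟨hr.1.le, hr.2.le⟩)
  have h1 := hf' c ⟨hc.1.le, hc.2.le⟩
  rw [h, sub_zero, le_div_iff₀ ht] at h1
  linarith

/-- Strong monotonicity gives injectivity; for surjectivity, solving `T x = y` amounts to finding a
fixed point of `x ↦ x - ε (T x - y)`, a contraction for small `ε`. -/
theorem bijective_of_strongly_monotone {E : Type*} [NormedAddCommGroup E] [InnerProductSpace ℝ E]
    [CompleteSpace E] {T : E → E} {c L : ℝ} (hc : 0 < c)
    (hL : ∀ x y, ‖T x - T y‖ ≤ L * ‖x - y‖)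
    (hT : ∀ x y, c * ‖x - y‖ ^ 2 ≤ ⟪T x - T y, x - y⟫) : Function.Bijective T := by
  refine ⟨fun x y h => ?_, fun y => ?_⟩
  · have h1 := hT x y
    rw [h, sub_self, inner_zero_left] at h1
    have h2 : ‖x - y‖ ^ 2 ≤ 0 := by
      by_contra hn
      push Not at hn
      nlinarith
    have h3 : ‖x - y‖ = 0 := by nlinarith [norm_nonneg (x - y)]
    exact sub_eq_zero.1 (norm_eq_zero.1 h3)
  · set A : ℝ := |L| + c with hA
    have hApos : 0 < A := by positivity
    have hcA : c ≤ A := by rw [hA]; linarith [abs_nonneg L]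
    -- The squared contraction factor is at most `1 - 2εc + ε²A²`; this `ε` minimizes it, with value
    -- `k`. Adding `c` in `A` ensures `0 < A` and `c ≤ A`, hence `0 ≤ k`.
    set ε : ℝ := c / A ^ 2 with hε
    have hεpos : 0 < ε := by positivity
    set k : ℝ := 1 - c ^ 2 / A ^ 2 with hk
    have hk1 : k < 1 := by rw [hk]; linarith [show 0 < c ^ 2 / A ^ 2 by positivity]
    have hk0 : 0 ≤ k := by
      rw [hk, sub_nonneg, div_le_one (by positivity)]
      gcongr
    have hcontr : ContractingWith (Real.sqrt k).toNNReal (fun x => x - ε • (T x - y)) := by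
      refine ⟨?_, LipschitzWith.of_dist_le_mul fun x z => ?_⟩
      · rw [Real.toNNReal_lt_one, Real.sqrt_lt' one_pos]
        simpa using hk1
      · rw [dist_eq_norm, dist_eq_norm, Real.coe_toNNReal _ (Real.sqrt_nonneg _)]
        have h1 : x - ε • (T x - y) - (z - ε • (T z - y)) = (x - z) - ε • (T x - T z) := by
          simp only [smul_sub]; abel
        rw [h1]
        refine (sq_le_sq₀ (norm_nonneg _) (by positivity)).1 ?_
        rw [mul_pow, Real.sq_sqrt hk0, norm_sub_sq_real, inner_smul_right, norm_smul, mul_pow,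
          Real.norm_eq_abs, sq_abs, real_inner_comm]
        have h2 := mul_le_mul_of_nonneg_left (hT x z) hεpos.le
        have h3 : ‖T x - T z‖ ^ 2 ≤ A ^ 2 * ‖x - z‖ ^ 2 := by
          rw [← mul_pow]
          refine pow_le_pow_left₀ (norm_nonneg _) ((hL x z).trans ?_) 2
          refine mul_le_mul_of_nonneg_right ?_ (norm_nonneg _)
          rw [hA]; linarith [le_abs_self L]
        have h4 := mul_le_mul_of_nonneg_left h3 (sq_nonneg ε)
        have h5 : ε ^ 2 * (A ^ 2 * ‖x - z‖ ^ 2) = c ^ 2 / A ^ 2 * ‖x - z‖ ^ 2 := by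
          rw [hε]; field_simp
        have h6 : ε * (c * ‖x - z‖ ^ 2) = c ^ 2 / A ^ 2 * ‖x - z‖ ^ 2 := by
          rw [hε]; field_simp
        have h7 : k * ‖x - z‖ ^ 2 = ‖x - z‖ ^ 2 - c ^ 2 / A ^ 2 * ‖x - z‖ ^ 2 := by rw [hk]; ring
        linarith
    have h := hcontr.fixedPoint_isFixedPt
    rw [Function.IsFixedPt, sub_eq_self, smul_eq_zero, or_iff_right hεpos.ne', sub_eq_zero] at h
    exact ⟨_, h⟩

/-! ### Actions of orbits and of broken orbits. -/

namespace WeakKAM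

variable {d : ℕ} {H : Phase d → ℝ} {m M : ℝ}

/-- The action of the orbit of `x` between the times `0` and `t`. -/
noncomputable def act (H : Phase d → ℝ) (t : ℝ) (x : Phase d) : ℝ :=
  ∫ s in (0 : ℝ)..t, lag H (flow H s x)

theorem Hypotheses.hasDerivAt_flow_fst (hH : Hypotheses H m M) (x : Phase d) (t : ℝ) :
    HasDerivAt (fun t => (flow H t x).1) (hamVectorField H (flow H t x)).1 t := by
  simpa using ((hH.hasDerivAt_flow x t).hasFDerivAt.fst).hasDerivAt

theorem Hypotheses.hasDerivAt_flow_snd (hH : Hypotheses H m M) (x : Phase d) (t : ℝ) :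
    HasDerivAt (fun t => (flow H t x).2) (hamVectorField H (flow H t x)).2 t := by
  simpa using ((hH.hasDerivAt_flow x t).hasFDerivAt.snd).hasDerivAt

theorem Hypotheses.continuous_lag_flow (hH : Hypotheses H m M) (x : Phase d) :
    Continuous fun s => lag H (flow H s x) := hH.continuous_lag.comp (hH.continuous_flow_time x)

theorem act_zero (x : Phase d) : act H 0 x = 0 := intervalIntegral.integral_same

theorem Hypotheses.hasDerivAt_act (hH : Hypotheses H m M) (x : Phase d) (t : ℝ) :
    HasDerivAt (fun t => act H t x) (lag H (flow H t x)) t :=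
  intervalIntegral.integral_hasDerivAt_right ((hH.continuous_lag_flow x).intervalIntegrable _ _)
    ((hH.continuous_lag_flow x).stronglyMeasurableAtFilter _ _) (hH.continuous_lag_flow x).continuousAt

theorem Hypotheses.act_add (hH : Hypotheses H m M) (s t : ℝ) (x : Phase d) :
    act H (s + t) x = act H s x + act H t (flow H s x) := by
  have hi := fun a b => (hH.continuous_lag_flow x).intervalIntegrable (μ := MeasureTheory.volume) a b
  rw [act, act, ← intervalIntegral.integral_add_adjacent_intervals (hi 0 s) (hi s (s + t))]
  congr 1
  simp only [act, ← hH.flow_add]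
  rw [intervalIntegral.integral_comp_add_left (fun r => lag H (flow H r x)), add_zero]

theorem Hypotheses.continuous_act (hH : Hypotheses H m M) (t : ℝ) : Continuous (act H t) :=
  intervalIntegral.continuous_parametric_intervalIntegral_of_continuous' (μ := MeasureTheory.volume)
    (f := fun x s => lag H (flow H s x))
    (hH.continuous_lag.comp (hH.continuous_flow.comp continuous_swap)) 0 t

theorem Hypotheses.act_phaseTranslate (hH : Hypotheses H m M) (hper : PeriodicHamiltonian H)
    (w : Fin d → ℤ) (t : ℝ) (x : Phase d) : act H t (phaseTranslate w x) = act H t x := by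
  simp only [act, hH.flow_phaseTranslate hper, lag_phaseTranslate hper]

theorem Hypotheses.hamAction_flow (hH : Hypotheses H m M) (t : ℝ) (x : Phase d) :
    hamAction H t (fun s => flow H s x) = act H t x := by
  unfold hamAction act
  congr 1
  funext s
  simp only [(hH.hasDerivAt_flow_fst x s).deriv]
  rfl

/-- `Chain H t a b c`: a broken orbit joins `a` to `b` in time `t` with total action `c`. -/
inductive Chain (H : Phase d → ℝ) : ℝ → Conf d → Conf d → ℝ → Prop
  | orbit (t : ℝ) (x : Phase d) (ht : 0 ≤ t) : Chain H t x.1 (flow H t x).1 (act H t x)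
  | append {s t : ℝ} {a b e : Conf d} {c c' : ℝ} (h : Chain H s a b c) (h' : Chain H t b e c') :
      Chain H (s + t) a e (c + c')

theorem Chain.nonneg {t c : ℝ} {a b : Conf d} (h : Chain H t a b c) : 0 ≤ t := by
  induction h with
  | orbit t x ht => exact ht
  | append _ _ h1 h2 => exact add_nonneg h1 h2

/-- `Chain` records neither the number of pieces nor their lengths, so a broken orbit can be cut at
any time. With `append`, this is the semigroup law behind the Lax-Oleinik operators. -/
theorem Hypotheses.chain_split (hH : Hypotheses H m M) {t c : ℝ} {a b : Conf d}
    (h : Chain H t a b c) {s : ℝ} (hs : 0 ≤ s) (hst : s ≤ t) :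
    ∃ θ c₁ c₂, Chain H s a θ c₁ ∧ Chain H (t - s) θ b c₂ ∧ c = c₁ + c₂ := by
  induction h generalizing s with
  | orbit t x ht =>
    refine ⟨(flow H s x).1, act H s x, act H (t - s) (flow H s x), .orbit s x hs, ?_, ?_⟩
    · have := Chain.orbit (H := H) (t - s) (flow H s x) (by linarith)
      rwa [← hH.flow_add, add_sub_cancel] at this
    · rw [← hH.act_add, add_sub_cancel]
  | @append s' t' a b e c c' h h' ih ih' =>
    rcases le_total s s' with hss | hss
    · obtain ⟨θ, c₁, c₂, h1, h2, rfl⟩ := ih hs hss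
      refine ⟨θ, c₁, c₂ + c', h1, ?_, by ring⟩
      rw [show s' + t' - s = s' - s + t' by ring]
      exact h2.append h'
    · obtain ⟨θ, c₁, c₂, h1, h2, rfl⟩ := ih' (s := s - s') (by linarith) (by linarith)
      refine ⟨θ, c + c₁, c₂, ?_, ?_, by ring⟩
      · rw [show s = s' + (s - s') by ring]
        exact h.append h1
      · rwa [show s' + t' - s = t' - (s - s') by ring]

theorem Hypotheses.chain_translate (hH : Hypotheses H m M) (hper : PeriodicHamiltonian H)
    (w : Fin d → ℤ) {t c : ℝ} {a b : Conf d} (h : Chain H t a b c) :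
    Chain H t (a + intVec w) (b + intVec w) c := by
  induction h with
  | orbit t x ht =>
    have := Chain.orbit (H := H) t (phaseTranslate w x) ht
    rwa [hH.act_phaseTranslate hper, hH.flow_phaseTranslate hper] at this
  | append _ _ h1 h2 => exact h1.append h2

/-! ### Comparison with a reference orbit, and growth of the action. -/

/-- The left side is the rate of change of `compPot` when `y` and `z` both move with the flow. The
test momentum `z.2 - 4Ms (y.1 - z.1)` is the gradient of `compPot` at `y.1`. The quadratic error in
the Taylor expansion of `H` is at most `2M‖y.1 - z.1‖²`, because `4Ms ≤ 1`, and is absorbed by the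
growth in time of the parabola's coefficient. -/
theorem Hypotheses.lag_compare (hH : Hypotheses H m M) {s : ℝ} (hs : 0 ≤ s) (h : 4 * M * s ≤ 1)
    (y z : Phase d) :
    ⟪(hamVectorField H z).2, y.1 - z.1⟫
      + ⟪z.2, (hamVectorField H y).1 - (hamVectorField H z).1⟫
      - (2 * M * ‖y.1 - z.1‖ ^ 2 + 2 * M * s *
        (2 * ⟪y.1 - z.1, (hamVectorField H y).1 - (hamVectorField H z).1⟫))
      ≤ lag H y - lag H z := by
  have hM := hH.nonneg
  have h1 := hH.fenchel y (z.2 - (4 * M * s) • (y.1 - z.1))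
  have h2 := hH.taylor_le z (y.1, z.2 - (4 * M * s) • (y.1 - z.1))
  simp only [sub_sub_cancel_left, inner_neg_right, inner_smul_right, inner_sub_left, norm_neg,
    norm_smul, inner_smul_left, Real.norm_eq_abs, mul_pow, sq_abs, conj_trivial] at h1 h2
  have h3 : M * ((4 * M * s) ^ 2 * ‖y.1 - z.1‖ ^ 2) ≤ M * ‖y.1 - z.1‖ ^ 2 := by
    have h4 : (4 * M * s) ^ 2 ≤ 1 := pow_le_one₀ (by positivity) h
    have h5 := mul_le_mul_of_nonneg_right h4 (sq_nonneg ‖y.1 - z.1‖)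
    exact mul_le_mul_of_nonneg_left (by linarith) hM
  have h6 : lag H z = ⟪z.2, (hamVectorField H z).1⟫ - H z := rfl
  rw [h6]
  simp only [mul_pow] at h3
  simp only [inner_sub_right, inner_sub_left] at *
  rw [real_inner_comm y.1 (hamVectorField H z).1, real_inner_comm z.1 (hamVectorField H z).1] at h2
  linarith

/-- The comparison potential attached to the orbit of `x`. -/
noncomputable def compPot (M s : ℝ) (z : Phase d) (q : Conf d) : ℝ :=
  ⟪z.2, q - z.1⟫ - 2 * M * s * ‖q - z.1‖ ^ 2

theorem Hypotheses.act_compare (hH : Hypotheses H m M) {s t : ℝ} (hs : 0 ≤ s) (ht : 0 ≤ t)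
    (h : 4 * M * (s + t) ≤ 1) (y z : Phase d) :
    act H t z + compPot M (s + t) (flow H t z) (flow H t y).1 - compPot M s z y.1
      ≤ act H t y := by
  have hder : ∀ r : ℝ, HasDerivAt (fun r => act H r y - act H r z
      - compPot M (s + r) (flow H r z) (flow H r y).1) (lag H (flow H r y) - lag H (flow H r z)
      - ((⟪(flow H r z).2, (hamVectorField H (flow H r y)).1 - (hamVectorField H (flow H r z)).1⟫
        + ⟪(hamVectorField H (flow H r z)).2, (flow H r y).1 - (flow H r z).1⟫)
        - (2 * M * ‖(flow H r y).1 - (flow H r z).1‖ ^ 2 + 2 * M * (s + r) *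
        (2 * ⟪(flow H r y).1 - (flow H r z).1,
          (hamVectorField H (flow H r y)).1 - (hamVectorField H (flow H r z)).1⟫)))) r := by
    intro r
    have hδ := (hH.hasDerivAt_flow_fst y r).sub (hH.hasDerivAt_flow_fst z r)
    have h1 : HasDerivAt (fun r : ℝ => 2 * M * (s + r)) (2 * M) r := by
      simpa using ((hasDerivAt_id r).const_add s).const_mul (2 * M)
    exact ((hH.hasDerivAt_act y r).sub (hH.hasDerivAt_act z r)).sub
      (((hH.hasDerivAt_flow_snd z r).inner ℝ hδ).sub (h1.mul hδ.norm_sq))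
  have := le_of_hasDerivAt_nonneg ht (fun r _ => hder r) (fun r hr => ?_)
  · simp only [act_zero, add_zero, hH.flow_zero] at this
    linarith
  · have h2 : 4 * M * (s + r) ≤ 1 := by
      refine le_trans ?_ h
      have := hH.nonneg
      have := hr.2
      gcongr
    have := hH.lag_compare (add_nonneg hs hr.1) h2 (flow H r y) (flow H r z)
    linarith

/-- At each break the potential terms cancel, since they depend on the position only. The starting
age `s` of the parabola is a parameter so that the second part can resume where the first one
stopped. -/
theorem Hypotheses.chain_compare (hH : Hypotheses H m M) {t c : ℝ} {a b : Conf d}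
    (hc : Chain H t a b c) {s : ℝ} (hs : 0 ≤ s) (h : 4 * M * (s + t) ≤ 1) (z : Phase d) :
    act H t z + compPot M (s + t) (flow H t z) b - compPot M s z a ≤ c := by
  induction hc generalizing s z with
  | orbit t x ht => exact hH.act_compare hs ht h x z
  | @append s' t' a b e c c' hc hc' ih ih' =>
    have h1 := ih hs (by nlinarith [hH.nonneg, hc'.nonneg]) z
    have h2 := ih' (add_nonneg hs hc.nonneg) (by rwa [add_assoc]) (flow H s' z)
    rw [← hH.flow_add] at h2
    rw [hH.act_add, ← add_assoc]
    linarith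

/-- Fenchel's inequality with the constant test momentum `e`, at which `H ≤ 3M/2`. -/
theorem Hypotheses.inner_sub_le_chain (hH : Hypotheses H m M) {t c : ℝ} {a b : Conf d}
    (hc : Chain H t a b c) {e : Conf d} (he : ‖e‖ ≤ 1) :
    ⟪e, b - a⟫ - 3 / 2 * M * t ≤ c := by
  induction hc with
  | orbit t x ht =>
    have hder : ∀ r : ℝ, HasDerivAt (fun r => act H r x - ⟪e, (flow H r x).1⟫ + 3 / 2 * M * r)
        (lag H (flow H r x) - (⟪e, (hamVectorField H (flow H r x)).1⟫ + ⟪(0 : Conf d), (flow H r x).1⟫)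
          + 3 / 2 * M) r := by
      intro r
      have h1 : HasDerivAt (fun r : ℝ => 3 / 2 * M * r) (3 / 2 * M) r := by
        simpa using (hasDerivAt_id r).const_mul (3 / 2 * M)
      exact ((hH.hasDerivAt_act x r).sub
        ((hasDerivAt_const r e).inner ℝ (hH.hasDerivAt_flow_fst x r))).add h1
    have := le_of_hasDerivAt_nonneg ht (fun r _ => hder r) (fun r hr => ?_)
    · simp only [act_zero, hH.flow_zero, mul_zero] at this
      rw [inner_sub_right]
      linarith
    · have h1 := hH.fenchel (flow H r x) e
      have h2 := hH.upper (flow H r x).1 e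
      have h3 : M / 2 * ‖e‖ ^ 2 ≤ M / 2 * 1 :=
        mul_le_mul_of_nonneg_left (pow_le_one₀ (norm_nonneg _) he) (by linarith [hH.nonneg])
      rw [inner_zero_left]
      linarith
  | @append s t a b f c c' h h' ih ih' =>
    rw [inner_sub_right] at *
    linarith

theorem Hypotheses.norm_sub_le_chain (hH : Hypotheses H m M) {t c : ℝ} {a b : Conf d}
    (hc : Chain H t a b c) : ‖b - a‖ - 3 / 2 * M * t ≤ c := by
  rcases eq_or_ne (b - a) 0 with h | h
  · have := hH.inner_sub_le_chain hc (e := 0) (by simp)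
    rw [h, norm_zero]
    rwa [inner_zero_left] at this
  · have := hH.inner_sub_le_chain hc (e := ‖b - a‖⁻¹ • (b - a)) (by
      rw [norm_smul, norm_inv, norm_norm, inv_mul_cancel₀ (norm_ne_zero_iff.2 h)])
    rwa [inner_smul_left, real_inner_self_eq_norm_sq, conj_trivial, sq, ← mul_assoc,
      inv_mul_cancel₀ (norm_ne_zero_iff.2 h), one_mul] at this

/-! ### Short times: twist property and regularity of the generating function. -/

/-- `τ` is so small that orbits of length at most `τ` minimize, and that the final position is
a strongly monotone function of the initial momentum. -/
structure SmallTime (H : Phase d → ℝ) (m M τ : ℝ) : Prop where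
  pos : 0 < τ
  le : 4 * M * τ ≤ 1
  monotone : ∀ s, 0 < s → s ≤ τ → ∀ q p p' : Conf d,
    m / 2 * s * ‖p - p'‖ ^ 2 ≤ ⟪(flow H s (q, p)).1 - (flow H s (q, p')).1, p - p'⟫

theorem SmallTime.mono {τ τ' : ℝ} (h : SmallTime H m M τ) (hH : Hypotheses H m M) (h0 : 0 < τ')
    (hle : τ' ≤ τ) : SmallTime H m M τ' where
  pos := h0
  le := le_trans (by have := hH.nonneg; gcongr) h.le
  monotone s hs hs' := h.monotone s hs (hs'.trans hle)

theorem Hypotheses.norm_flow_sub_le (hH : Hypotheses H m M) {t : ℝ} (ht : 0 ≤ t)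
    (h : 4 * M * t ≤ 1) (x y : Phase d) : ‖flow H t x - flow H t y‖ ≤ 2 * ‖x - y‖ := by
  have h1 := hH.dist_flow_le_of_nonneg ht x y
  have h2 : Real.exp (M * t) ≤ 2 := by
    have h3 : Real.exp (M * t) ≤ Real.exp (1 / 4) := Real.exp_le_exp.2 (by linarith)
    have h4 := Real.add_one_le_exp (-(1 / 4) : ℝ)
    rw [Real.exp_neg] at h4
    have h5 := Real.exp_pos (1 / 4 : ℝ)
    have h6 : Real.exp (1 / 4 : ℝ) ≤ 4 / 3 := by
      rw [← inv_inv (Real.exp (1 / 4)), inv_le_comm₀ (by positivity) (by norm_num)]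
      linarith
    linarith
  rw [dist_eq_norm, dist_eq_norm] at h1
  nlinarith [norm_nonneg (x - y)]

theorem Hypotheses.norm_flow_sub_sub_le (hH : Hypotheses H m M) {t : ℝ} (ht : 0 ≤ t)
    (h : 4 * M * t ≤ 1) (x y : Phase d) :
    ‖(flow H t x - flow H t y) - (x - y)‖ ≤ 2 * M * t * ‖x - y‖ := by
  have hder : ∀ r : ℝ, HasDerivAt (fun r => flow H r x - flow H r y)
      (hamVectorField H (flow H r x) - hamVectorField H (flow H r y)) r := fun r =>
    (hH.hasDerivAt_flow x r).sub (hH.hasDerivAt_flow y r)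
  have := norm_image_sub_le_of_norm_deriv_le_segment' (f := fun r => flow H r x - flow H r y)
    (C := M * (2 * ‖x - y‖)) (a := 0) (b := t)
    (fun r _ => (hder r).hasDerivWithinAt) (fun r hr => ?_) t ⟨ht, le_rfl⟩
  · simp only [hH.flow_zero, sub_zero] at this
    linarith
  · refine (hH.norm_hamVectorField_sub_le _ _).trans (mul_le_mul_of_nonneg_left ?_ hH.nonneg)
    refine hH.norm_flow_sub_le hr.1 (le_trans ?_ h) x y
    have := hH.nonneg
    have := hr.2.le
    gcongr

/-- For short times the momentum difference stays within `2MrN` of `p - p'` and the position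
difference has size at most `2MrN`. The velocity difference splits into `A` (only the momentum
changes), where convexity contributes at least `(3/4) m N²`, and `B` (only the position changes).
The errors total at most `6M²rN² ≤ (m/4) N²`. -/
theorem Hypotheses.deriv_inner_ge (hH : Hypotheses H m M) {r : ℝ} (hr : 0 ≤ r)
    (h1 : 16 * M * r ≤ 1) (h2 : 24 * M ^ 2 * r ≤ m) (q p p' : Conf d) :
    m / 2 * ‖p - p'‖ ^ 2 ≤ ⟪(hamVectorField H (flow H r (q, p))).1
      - (hamVectorField H (flow H r (q, p'))).1, p - p'⟫ := by
  have hM := hH.nonneg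
  have hm := hH.m_pos
  have h4 : 4 * M * r ≤ 1 := by nlinarith [mul_nonneg hM hr]
  set x := flow H r (q, p) with hx
  set y := flow H r (q, p') with hy
  set N := ‖p - p'‖ with hN
  have hN0 : 0 ≤ N := norm_nonneg _
  have hxy0 : ‖((q, p) : Phase d) - (q, p')‖ = N := by
    rw [Prod.mk_sub_mk, sub_self, Prod.norm_mk, norm_zero, max_eq_right (norm_nonneg _)]
  have e1 := hH.norm_flow_sub_le hr h4 (q, p) (q, p')
  have e2 := hH.norm_flow_sub_sub_le hr h4 (q, p) (q, p')
  rw [hxy0, ← hx, ← hy] at e1 e2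
  have e3 : ‖x.1 - y.1‖ ≤ 2 * M * r * N := by
    simpa using (_root_.norm_fst_le _).trans e2
  have e4 : ‖(x.2 - y.2) - (p - p')‖ ≤ 2 * M * r * N := by
    simpa using (_root_.norm_snd_le _).trans e2
  have e5 : ‖x.2 - y.2‖ ≤ 2 * N := (_root_.norm_snd_le (x - y)).trans e1
  have e6 : N - 2 * M * r * N ≤ ‖x.2 - y.2‖ := by
    have := norm_sub_norm_le (p - p') (x.2 - y.2)
    rw [norm_sub_rev (p - p')] at this
    linarith
  have f1 := hH.monotone_momentum x.1 y.2 (x.2 - y.2)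
  rw [add_sub_cancel] at f1
  have f2 : ‖(hamVectorField H (x.1, x.2)).1 - (hamVectorField H (x.1, y.2)).1‖ ≤ M * (2 * N) := by
    refine ((_root_.norm_fst_le (hamVectorField H (x.1, x.2) - hamVectorField H (x.1, y.2))).trans
      (hH.norm_hamVectorField_sub_le _ _)).trans (mul_le_mul_of_nonneg_left ?_ hM)
    rw [Prod.mk_sub_mk, sub_self, Prod.norm_mk, norm_zero, max_eq_right (norm_nonneg _)]
    exact e5
  have f3 : ‖(hamVectorField H (x.1, y.2)).1 - (hamVectorField H (y.1, y.2)).1‖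
      ≤ M * (2 * M * r * N) := by
    refine ((_root_.norm_fst_le (hamVectorField H (x.1, y.2) - hamVectorField H (y.1, y.2))).trans
      (hH.norm_hamVectorField_sub_le _ _)).trans (mul_le_mul_of_nonneg_left ?_ hM)
    rw [Prod.mk_sub_mk, sub_self, Prod.norm_mk, norm_zero, max_eq_left (norm_nonneg _)]
    exact e3
  set A := (hamVectorField H (x.1, x.2)).1 - (hamVectorField H (x.1, y.2)).1
  set B := (hamVectorField H (x.1, y.2)).1 - (hamVectorField H (y.1, y.2)).1
  have g0 : (hamVectorField H x).1 - (hamVectorField H y).1 = A + B := by simp [A, B]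
  have g1 : ⟪A, p - p'⟫ = ⟪A, x.2 - y.2⟫ - ⟪A, (x.2 - y.2) - (p - p')⟫ := by
    rw [← inner_sub_right, sub_sub_cancel]
  have g2 := (real_inner_le_norm A ((x.2 - y.2) - (p - p'))).trans
    (mul_le_mul f2 e4 (norm_nonneg _) (by positivity))
  have g3 := (abs_le.1 (abs_real_inner_le_norm B (p - p'))).1
  have g4 : ‖B‖ * ‖p - p'‖ ≤ M * (2 * M * r * N) * N := mul_le_mul_of_nonneg_right f3 hN0
  have g5 : (N - 2 * M * r * N) ^ 2 ≤ ‖x.2 - y.2‖ ^ 2 := by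
    refine pow_le_pow_left₀ ?_ e6 2
    have : 2 * M * r * N ≤ 1 * N := mul_le_mul_of_nonneg_right (by linarith) hN0
    linarith
  have g6 : 3 / 4 * N ^ 2 ≤ (N - 2 * M * r * N) ^ 2 := by
    have : (3 / 4 : ℝ) ≤ (1 - 2 * M * r) ^ 2 := by nlinarith [sq_nonneg (2 * M * r)]
    have := mul_le_mul_of_nonneg_right this (sq_nonneg N)
    linarith
  have g7 := mul_le_mul_of_nonneg_left (g6.trans g5) hm.le
  have g8 := mul_le_mul_of_nonneg_right h2 (sq_nonneg N)
  rw [g0, inner_add_left, g1]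
  nlinarith

theorem Hypotheses.exists_smallTime (hH : Hypotheses H m M) : ∃ τ, SmallTime H m M τ := by
  have hM := hH.nonneg
  have hm := hH.m_pos
  refine ⟨min (1 / (16 * (M + 1))) (m / (24 * (M ^ 2 + 1))), ?_, ?_, ?_⟩
  · positivity
  · have h1 := min_le_left (1 / (16 * (M + 1))) (m / (24 * (M ^ 2 + 1)))
    rw [le_div_iff₀ (by positivity)] at h1
    nlinarith [show 0 < min (1 / (16 * (M + 1))) (m / (24 * (M ^ 2 + 1))) by positivity]
  · intro s hs hs' q p p'
    have h1 := hs'.trans (min_le_left (1 / (16 * (M + 1))) (m / (24 * (M ^ 2 + 1))))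
    have h2 := hs'.trans (min_le_right (1 / (16 * (M + 1))) (m / (24 * (M ^ 2 + 1))))
    rw [le_div_iff₀ (by positivity)] at h1 h2
    have hder : ∀ r : ℝ, HasDerivAt (fun r => ⟪(flow H r (q, p)).1 - (flow H r (q, p')).1, p - p'⟫
        - m / 2 * r * ‖p - p'‖ ^ 2) (⟪(flow H r (q, p)).1 - (flow H r (q, p')).1, (0 : Conf d)⟫
        + ⟪(hamVectorField H (flow H r (q, p))).1 - (hamVectorField H (flow H r (q, p'))).1, p - p'⟫
        - m / 2 * ‖p - p'‖ ^ 2) r := by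
      intro r
      have h3 : HasDerivAt (fun r : ℝ => m / 2 * r * ‖p - p'‖ ^ 2) (m / 2 * ‖p - p'‖ ^ 2) r := by
        simpa using ((hasDerivAt_id r).const_mul (m / 2)).mul_const (‖p - p'‖ ^ 2)
      exact (((hH.hasDerivAt_flow_fst (q, p) r).sub (hH.hasDerivAt_flow_fst (q, p') r)).inner ℝ
        (hasDerivAt_const r (p - p'))).sub h3
    have := le_of_hasDerivAt_nonneg hs.le (fun r _ => hder r) (fun r hr => ?_)
    · simp only [hH.flow_zero, sub_self, inner_zero_left, mul_zero, zero_mul] at this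
      linarith
    · rw [inner_zero_right]
      have := hH.deriv_inner_ge hr.1 (by nlinarith [hr.1, hr.2]) (by nlinarith [hr.1, hr.2, sq_nonneg M]) q p p'
      linarith

/-- The initial condition of the orbit joining `q₀` to `q₁` in time `t`. -/
noncomputable def joinPt (H : Phase d → ℝ) (t : ℝ) (q₀ q₁ : Conf d) : Phase d :=
  (q₀, initialMomentum H t q₀ q₁)

theorem SmallTime.bijective {τ : ℝ} (hτ : SmallTime H m M τ) (hH : Hypotheses H m M) {s : ℝ}
    (hs : 0 < s) (hsτ : s ≤ τ) (q : Conf d) :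
    Function.Bijective (fun p : Conf d => (flow H s (q, p)).1) := by
  refine bijective_of_strongly_monotone (c := m / 2 * s) (L := 2)
    (by have := hH.m_pos; positivity) (fun p p' => ?_) (hτ.monotone s hs hsτ q)
  have h := hH.norm_flow_sub_le hs.le (le_trans (by have := hH.nonneg; gcongr) hτ.le) (q, p) (q, p')
  have e : ‖((q, p) : Phase d) - (q, p')‖ = ‖p - p'‖ := by
    rw [Prod.mk_sub_mk, sub_self, Prod.norm_mk, norm_zero, max_eq_right (norm_nonneg _)]
  rw [e] at h
  exact (_root_.norm_fst_le _).trans h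

theorem SmallTime.isTwistTime {τ : ℝ} (hτ : SmallTime H m M τ) (hH : Hypotheses H m M) :
    IsTwistTime H τ := fun _ hs hsτ q => hτ.bijective hH hs hsτ q

theorem IsTwistTime.flow_joinPt {t : ℝ} (ht : IsTwistTime H t) (h0 : 0 < t) (q₀ q₁ : Conf d) :
    (flow H t (joinPt H t q₀ q₁)).1 = q₁ :=
  Function.invFun_eq (f := fun p : Conf d => (flow H t (q₀, p)).1) ((ht t h0 le_rfl q₀).2 q₁)

theorem Hypotheses.genFun_eq (hH : Hypotheses H m M) (t : ℝ) (q₀ q₁ : Conf d) :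
    genFun H t q₀ q₁ = act H t (joinPt H t q₀ q₁) := hH.hamAction_flow t _

theorem IsTwistTime.eq_joinPt {t : ℝ} (ht : IsTwistTime H t) (h0 : 0 < t) (x : Phase d) :
    joinPt H t x.1 (flow H t x).1 = x :=
  Prod.ext rfl ((ht t h0 le_rfl x.1).1 (ht.flow_joinPt h0 x.1 (flow H t x).1))

theorem IsTwistTime.chain_genFun {t : ℝ} (ht : IsTwistTime H t) (hH : Hypotheses H m M)
    (h0 : 0 < t) (q₀ q₁ : Conf d) : Chain H t q₀ q₁ (genFun H t q₀ q₁) := by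
  have := Chain.orbit (H := H) t (joinPt H t q₀ q₁) h0.le
  rwa [ht.flow_joinPt h0, ← hH.genFun_eq] at this

/-- The reference orbit has the same end points as the broken one, so both potential terms vanish.
-/
theorem SmallTime.genFun_le_chain {t : ℝ} (ht : SmallTime H m M t) (hH : Hypotheses H m M)
    {a b : Conf d} {c : ℝ} (hc : Chain H t a b c) : genFun H t a b ≤ c := by
  have h := hH.chain_compare hc le_rfl (by rw [zero_add]; exact ht.le) (joinPt H t a b)
  rw [hH.genFun_eq]
  have h1 : (joinPt H t a b).1 = a := rfl
  simpa [compPot, (ht.isTwistTime hH).flow_joinPt ht.pos, h1] using h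

theorem SmallTime.joinPt_translate {t : ℝ} (ht : SmallTime H m M t) (hH : Hypotheses H m M)
    (hper : PeriodicHamiltonian H) (w : Fin d → ℤ) (a b : Conf d) :
    joinPt H t (a + intVec w) (b + intVec w) = phaseTranslate w (joinPt H t a b) := by
  have h := (ht.isTwistTime hH).eq_joinPt ht.pos (phaseTranslate w (joinPt H t a b))
  rw [hH.flow_phaseTranslate hper] at h
  simp only [phaseTranslate, (ht.isTwistTime hH).flow_joinPt ht.pos] at h
  exact h

/-- Strong monotonicity of `p ↦ Q^t(q, p)` makes its inverse Lipschitz; moving the initial point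
moves `Q^t` by at most twice as much. -/
theorem SmallTime.exists_norm_joinPt_sub_le {t : ℝ} (ht : SmallTime H m M t)
    (hH : Hypotheses H m M) : ∃ C : ℝ, 0 ≤ C ∧ ∀ a b a' b' : Conf d,
      ‖joinPt H t a' b' - joinPt H t a b‖ ≤ C * (‖a' - a‖ + ‖b' - b‖) := by
  have hc : 0 < m / 2 * t := by have := hH.m_pos; have := ht.pos; positivity
  refine ⟨2 / (m / 2 * t) + 1, by positivity, fun a b a' b' => ?_⟩
  set p := initialMomentum H t a b
  set p' := initialMomentum H t a' b'
  have hT := ht.isTwistTime hH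
  have e1 : (flow H t (a, p)).1 = b := hT.flow_joinPt ht.pos a b
  have e2 : (flow H t (a', p')).1 = b' := hT.flow_joinPt ht.pos a' b'
  have h1 := ht.monotone t ht.pos le_rfl a p' p
  have h2 : ‖(flow H t (a, p')).1 - (flow H t (a', p')).1‖ ≤ 2 * ‖a' - a‖ := by
    refine (_root_.norm_fst_le (flow H t (a, p') - flow H t (a', p'))).trans
      ((hH.norm_flow_sub_le ht.pos.le ht.le _ _).trans ?_)
    rw [Prod.mk_sub_mk, sub_self, Prod.norm_mk, norm_zero, max_eq_left (norm_nonneg _),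
      norm_sub_rev]
  have h3 : ‖(flow H t (a, p')).1 - (flow H t (a, p)).1‖ ≤ 2 * ‖a' - a‖ + ‖b' - b‖ := by
    have := norm_sub_le_norm_sub_add_norm_sub (flow H t (a, p')).1 (flow H t (a', p')).1
      (flow H t (a, p)).1
    rw [e1, e2] at *
    linarith
  have h4 : m / 2 * t * ‖p' - p‖ ≤ 2 * (‖a' - a‖ + ‖b' - b‖) := by
    rcases (norm_nonneg (p' - p)).eq_or_lt with h0 | h0
    · rw [← h0]; simp; positivity
    · have h5 := h1.trans (real_inner_le_norm _ _)
      rw [sq, ← mul_assoc] at h5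
      have := le_of_mul_le_mul_right h5 h0
      linarith [norm_nonneg (b' - b)]
  have h5 : ‖p' - p‖ ≤ 2 / (m / 2 * t) * (‖a' - a‖ + ‖b' - b‖) := by
    rw [div_mul_eq_mul_div, le_div_iff₀ hc]
    linarith
  have h6 : 0 ≤ 2 / (m / 2 * t) * (‖a' - a‖ + ‖b' - b‖) := by positivity
  refine max_le ?_ ?_
  · change ‖a' - a‖ ≤ _
    linarith [norm_nonneg (b' - b)]
  · change ‖p' - p‖ ≤ _
    linarith [norm_nonneg (b' - b), norm_nonneg (a' - a)]

theorem SmallTime.continuous_joinPt {t : ℝ} (ht : SmallTime H m M t)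
    (hH : Hypotheses H m M) : Continuous fun z : Conf d × Conf d => joinPt H t z.1 z.2 := by
  obtain ⟨C, hC, h⟩ := ht.exists_norm_joinPt_sub_le hH
  refine LipschitzWith.continuous (K := (C * 2).toNNReal) (LipschitzWith.of_dist_le_mul ?_)
  intro z z'
  rw [dist_eq_norm, dist_eq_norm, Real.coe_toNNReal _ (by positivity), mul_assoc]
  refine (h _ _ _ _).trans (mul_le_mul_of_nonneg_left ?_ hC)
  have h1 := _root_.norm_fst_le (z - z')
  have h2 := _root_.norm_snd_le (z - z')
  simp only [Prod.fst_sub, Prod.snd_sub] at h1 h2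
  linarith

theorem SmallTime.continuous_genFun {t : ℝ} (ht : SmallTime H m M t)
    (hH : Hypotheses H m M) : Continuous fun z : Conf d × Conf d => genFun H t z.1 z.2 := by
  simp only [hH.genFun_eq]
  exact (hH.continuous_act t).comp (ht.continuous_joinPt hH)

theorem SmallTime.genFun_translate {t : ℝ} (ht : SmallTime H m M t) (hH : Hypotheses H m M)
    (hper : PeriodicHamiltonian H) (w : Fin d → ℤ) (a b : Conf d) :
    genFun H t (a + intVec w) (b + intVec w) = genFun H t a b := by
  rw [hH.genFun_eq, hH.genFun_eq, ht.joinPt_translate hH hper, hH.act_phaseTranslate hper]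

/-- The orbit with the perturbed end point serves as reference and the unperturbed one as
competitor. This bounds the perturbed action from above, with slope the perturbed end momentum,
which is then replaced by the unperturbed one at a Lipschitz cost. -/
theorem SmallTime.exists_genFun_semiconcave {t : ℝ} (ht : SmallTime H m M t)
    (hH : Hypotheses H m M) : ∃ C : ℝ, 0 ≤ C ∧ ∀ a b h : Conf d,
      genFun H t a (b + h) ≤ genFun H t a b + ⟪(flow H t (joinPt H t a b)).2, h⟫ + C * ‖h‖ ^ 2 ∧
      genFun H t (a + h) b ≤ genFun H t a b - ⟪(joinPt H t a b).2, h⟫ + C * ‖h‖ ^ 2 := by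
  obtain ⟨C, hC, hj⟩ := ht.exists_norm_joinPt_sub_le hH
  have hM := hH.nonneg
  have h0 := ht.pos
  have hT := ht.isTwistTime hH
  have hs : 4 * M * (0 + t) ≤ 1 := by rw [zero_add]; exact ht.le
  -- `C` is the Lipschitz constant of `joinPt`, the factor `2` that of the flow, and `2Mt` the
  -- coefficient of the parabola at time `t`. At time `0` the parabola is absent, so the second
  -- estimate has room to spare.
  refine ⟨2 * C + 2 * M * t, by positivity, fun a b h => ⟨?_, ?_⟩⟩
  · have h1 := hH.act_compare le_rfl h0.le hs (joinPt H t a b) (joinPt H t a (b + h))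
    simp only [compPot, hT.flow_joinPt h0] at h1
    have h2 := hj a b a (b + h)
    rw [sub_self, norm_zero, add_sub_cancel_left, zero_add] at h2
    have h3 := (hH.norm_flow_sub_le h0.le ht.le (joinPt H t a (b + h)) (joinPt H t a b)).trans
      (mul_le_mul_of_nonneg_left h2 two_pos.le)
    have h4 := (real_inner_le_norm ((flow H t (joinPt H t a (b + h))).2
      - (flow H t (joinPt H t a b)).2) h).trans
      (mul_le_mul_of_nonneg_right ((_root_.norm_snd_le (flow H t (joinPt H t a (b + h))
        - flow H t (joinPt H t a b))).trans h3) (norm_nonneg _))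
    have h5 : (joinPt H t a (b + h)).1 = (joinPt H t a b).1 := rfl
    rw [h5, sub_self, sub_add_cancel_left, inner_zero_right, inner_neg_right, norm_neg, norm_zero] at h1
    rw [inner_sub_left] at h4
    rw [hH.genFun_eq, hH.genFun_eq]
    nlinarith
  · have h1 := hH.act_compare le_rfl h0.le hs (joinPt H t a b) (joinPt H t (a + h) b)
    simp only [compPot, hT.flow_joinPt h0] at h1
    have h2 := hj a b (a + h) b
    rw [sub_self, norm_zero, add_sub_cancel_left, add_zero] at h2
    have h4 := (abs_le.1 (abs_real_inner_le_norm ((joinPt H t (a + h) b).2 - (joinPt H t a b).2) h)).1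
    have h6 := mul_le_mul_of_nonneg_right ((_root_.norm_snd_le (joinPt H t (a + h) b
        - joinPt H t a b)).trans h2) (norm_nonneg h)
    rw [Prod.snd_sub] at h6
    have h5 : (joinPt H t a b).1 - (joinPt H t (a + h) b).1 = -h := by simp [joinPt]
    rw [h5, sub_self, inner_zero_right, inner_neg_right, norm_neg, norm_zero] at h1
    rw [inner_sub_left] at h4
    rw [hH.genFun_eq, hH.genFun_eq]
    have h7 : 0 ≤ M * t * ‖h‖ ^ 2 := by positivity
    have h8 : 0 ≤ C * ‖h‖ ^ 2 := by positivity
    nlinarith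

/-! ### Minimal action and weak KAM solutions in terms of broken orbits. -/

theorem IsTwistTime.chain_sum {s : ℝ} (hs : IsTwistTime H s) (hH : Hypotheses H m M) (h0 : 0 < s)
    (θ : ℕ → Conf d) (n : ℕ) :
    Chain H (n * s) (θ 0) (θ n) (∑ i ∈ Finset.range n, genFun H s (θ i) (θ (i + 1))) := by
  induction n with
  | zero => simpa [hH.flow_zero, act_zero] using Chain.orbit (H := H) 0 (θ 0, 0) le_rfl
  | succ n ih =>
    rw [Finset.sum_range_succ, Nat.cast_succ, add_mul, one_mul]
    exact ih.append (hs.chain_genFun hH h0 _ _)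

/-- The chain is cut at the multiples of `s`, and each piece is replaced by the minimizing orbit
between its end points. -/
theorem SmallTime.exists_sum_le_chain {s : ℝ} (hs : SmallTime H m M s) (hH : Hypotheses H m M)
    (n : ℕ) {a b : Conf d} {c : ℝ} (h : Chain H ((n + 1 : ℕ) * s) a b c) :
    ∃ θ : ℕ → Conf d, θ 0 = a ∧ θ (n + 1) = b ∧
      ∑ i ∈ Finset.range (n + 1), genFun H s (θ i) (θ (i + 1)) ≤ c := by
  induction n generalizing a c with
  | zero =>
    refine ⟨fun i => if i = 0 then a else b, by simp, by simp, ?_⟩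
    simpa using hs.genFun_le_chain hH (by simpa using h)
  | succ n ih =>
    have h0 := hs.pos
    obtain ⟨e, c₁, c₂, h1, h2, rfl⟩ := hH.chain_split h h0.le
      (by push_cast; nlinarith [mul_nonneg (Nat.cast_nonneg (α := ℝ) n) h0.le])
    have e1 : ((n + 1 + 1 : ℕ) * s - s : ℝ) = (n + 1 : ℕ) * s := by push_cast; ring
    rw [e1] at h2
    obtain ⟨θ, hθ0, hθ1, hθ⟩ := ih h2
    refine ⟨fun i => if i = 0 then a else θ (i - 1), by simp, by simpa using hθ1, ?_⟩
    rw [Finset.sum_range_succ']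
    simp only [Nat.add_eq_zero_iff, one_ne_zero, and_false, if_false, if_true, Nat.add_sub_cancel,
      zero_add, Nat.sub_self, hθ0]
    linarith [hs.genFun_le_chain hH h1]

theorem Hypotheses.minAction_le (hH : Hypotheses H m M) {t c : ℝ} (ht : 0 < t) {a b : Conf d}
    (h : Chain H t a b c) : minAction H t a b ≤ c := by
  obtain ⟨τ, hτ⟩ := hH.exists_smallTime
  obtain ⟨n, hn⟩ := exists_nat_gt (t / τ)
  rw [div_lt_iff₀ hτ.pos] at hn
  have hs : SmallTime H m M (t / (n + 1 : ℕ)) := by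
    refine hτ.mono hH (by positivity) ?_
    rw [div_le_iff₀ (by positivity)]
    push_cast
    nlinarith [hτ.pos]
  have e : ((n + 1 : ℕ) : ℝ) * (t / (n + 1 : ℕ)) = t := by field_simp
  obtain ⟨θ, h0, h1, h2⟩ := hs.exists_sum_le_chain hH n (by rwa [e])
  refine le_trans ?_ (EReal.coe_le_coe_iff.2 h2)
  exact iInf_le_of_le (n + 1) (iInf_le_of_le n.succ_pos (iInf_le_of_le (hs.isTwistTime hH)
    (iInf_le_of_le θ (iInf_le_of_le h0 (iInf_le_of_le h1 le_rfl)))))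

theorem Hypotheses.le_minAction (hH : Hypotheses H m M) {t r : ℝ} (ht : 0 < t) {a b : Conf d}
    (h : ∀ c, Chain H t a b c → r ≤ c) : (r : EReal) ≤ minAction H t a b := by
  refine le_iInf fun n => le_iInf fun hn => le_iInf fun hs => le_iInf fun θ => le_iInf fun h0 =>
    le_iInf fun h1 => EReal.coe_le_coe_iff.2 (h _ ?_)
  have hn' : (0 : ℝ) < n := Nat.cast_pos.2 hn
  have := hs.chain_sum hH (by positivity) θ n
  rwa [h0, h1, mul_div_cancel₀ _ hn'.ne'] at this

/-- Removes the extended reals: `u` is dominated by the action along every broken orbit, and the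
bound is attained up to any `ε`. Everything below works with this form. -/
theorem Hypotheses.isWeakKAM_iff (hH : Hypotheses H m M) {a : ℝ} {u : Conf d → ℝ} :
    IsWeakKAM H a u ↔ ∀ t, 0 < t → ∀ q,
      (∀ θ c, Chain H t θ q c → u q ≤ u θ + c + t * a) ∧
      ∀ ε, 0 < ε → ∃ θ c, Chain H t θ q c ∧ u θ + c + t * a < u q + ε := by
  have key : ∀ t, 0 < t → ∀ q r, (∀ θ c, Chain H t θ q c → r ≤ u θ + c + t * a) →
      (r : EReal) ≤ laxOleinik H t u q + ((t * a : ℝ) : EReal) := by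
    intro t ht q r h
    have h1 : ((r - t * a : ℝ) : EReal) ≤ laxOleinik H t u q := by
      rw [laxOleinik, if_neg ht.ne']
      refine le_iInf fun θ => ?_
      have h2 := hH.le_minAction (r := r - t * a - u θ) ht
        (fun c hc => by linarith [h θ c hc] : ∀ c, Chain H t θ q c → r - t * a - u θ ≤ c)
      have h3 := add_le_add_right h2 (u θ : EReal)
      rwa [← EReal.coe_add, add_sub_cancel] at h3
    have h2 := add_le_add_left h1 ((t * a : ℝ) : EReal)
    rwa [← EReal.coe_add, sub_add_cancel] at h2
  have key' : ∀ t, 0 < t → ∀ q θ c, Chain H t θ q c →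
      laxOleinik H t u q + ((t * a : ℝ) : EReal) ≤ ((u θ + c + t * a : ℝ) : EReal) := by
    intro t ht q θ c hc
    rw [EReal.coe_add, EReal.coe_add, laxOleinik, if_neg ht.ne']
    gcongr
    exact iInf_le_of_le θ (by gcongr; exact hH.minAction_le ht hc)
  constructor
  · intro h t ht q
    have hq := h t ht.le q
    refine ⟨fun θ c hc => ?_, fun ε hε => ?_⟩
    · have := key' t ht q θ c hc
      rw [hq] at this
      exact EReal.coe_le_coe_iff.1 this
    · by_contra! hn
      have := key t ht q (u q + ε) hn
      rw [hq, EReal.coe_le_coe_iff] at this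
      linarith
  · intro h t ht q
    rcases ht.eq_or_lt with rfl | ht
    · simp [laxOleinik]
    refine le_antisymm ?_ (key t ht q _ (h t ht q).1)
    refine EReal.le_of_forall_lt_iff_le.1 fun z hz => ?_
    obtain ⟨θ, c, hc, hlt⟩ := (h t ht q).2 (z - u q) (sub_pos.2 (EReal.coe_lt_coe_iff.1 hz))
    refine (key' t ht q θ c hc).trans (EReal.coe_le_coe_iff.2 ?_)
    linarith

/-! ### Periodicity and regularity of infimal convolutions. -/

theorem exists_norm_add_intVec_le (d : ℕ) :
    ∃ R : ℝ, 0 ≤ R ∧ ∀ q : Conf d, ∃ w : Fin d → ℤ, ‖q + intVec w‖ ≤ R := by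
  refine ⟨Real.sqrt d, Real.sqrt_nonneg _, fun q => ⟨fun i => -⌊q i⌋, ?_⟩⟩
  rw [EuclideanSpace.norm_eq]
  refine Real.sqrt_le_sqrt ((Finset.sum_le_card_nsmul Finset.univ _ 1 fun i _ => ?_).trans (by simp))
  have h1 := Int.floor_le (q i)
  have h2 := Int.lt_floor_add_one (q i)
  have h3 : (q + intVec fun i => -⌊q i⌋) i = q i - ⌊q i⌋ := by simp [intVec, sub_eq_add_neg]
  rw [h3, Real.norm_eq_abs, sq_abs]
  nlinarith

theorem exists_bound_of_periodic {G : Conf d × Conf d → ℝ} (hG : Continuous G)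
    (hper : ∀ (w : Fin d → ℤ) (a b : Conf d), G (a + intVec w, b + intVec w) = G (a, b)) (R : ℝ) :
    ∃ B, ∀ a b : Conf d, ‖b - a‖ ≤ R → G (a, b) ≤ B := by
  obtain ⟨R₀, -, h₀⟩ := exists_norm_add_intVec_le d
  obtain ⟨B, hB⟩ := (((isCompact_closedBall (0 : Conf d) (R₀ + R)).prod
    (isCompact_closedBall (0 : Conf d) R₀)).image hG).bddAbove
  refine ⟨B, fun a b hab => ?_⟩
  obtain ⟨w, hw⟩ := h₀ b
  rw [← hper w a b]
  refine hB ⟨_, ⟨?_, ?_⟩, rfl⟩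
  · rw [mem_closedBall_zero_iff]
    have := norm_sub_norm_le (a + intVec w) (b + intVec w)
    rw [add_sub_add_right_eq_sub, norm_sub_rev] at this
    simp only
    linarith
  · simpa using hw

/-- A near-minimizer competes with its integer translate near `q`, whose cost is at most `B`; linear
growth of the action then confines it to distance `R`. Modulo `ℤ^d` only a compact set of pairs
remains, so the final momenta are bounded by `P`. The constants do not depend on `f`, which gives
estimates uniform in time for `minCost`. -/
theorem SmallTime.exists_infConv_regular {t : ℝ} (ht : SmallTime H m M t) (hH : Hypotheses H m M)
    (hper : PeriodicHamiltonian H) : ∃ P C R : ℝ, 0 ≤ P ∧ 0 ≤ C ∧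
      ∀ f F : Conf d → ℝ, PeriodicFunction f → (∀ θ q, F q ≤ f θ + genFun H t θ q) →
        (∀ q ε, 0 < ε → ∃ θ, f θ + genFun H t θ q < F q + ε) →
        (∀ q h, F (q + h) ≤ F q + P * ‖h‖ + C * ‖h‖ ^ 2) ∧
        ∀ q θ, f θ + genFun H t θ q ≤ F q + 1 →
          ‖q - θ‖ ≤ R ∧ ‖(flow H t (joinPt H t θ q)).2‖ ≤ P := by
  obtain ⟨R₀, -, h₀⟩ := exists_norm_add_intVec_le d
  obtain ⟨B, hB⟩ := exists_bound_of_periodic (ht.continuous_genFun hH)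
    (ht.genFun_translate hH hper) R₀
  obtain ⟨C, hC, hsc⟩ := ht.exists_genFun_semiconcave hH
  set R := B + 1 + 3 / 2 * M * t with hR
  obtain ⟨P, hP⟩ := exists_bound_of_periodic (G := fun z => ‖(flow H t (joinPt H t z.1 z.2)).2‖)
    ((hH.continuous_flow_map t).comp (ht.continuous_joinPt hH)).snd.norm
    (fun w a b => by
      simp only [ht.joinPt_translate hH hper, hH.flow_phaseTranslate hper]
      rfl) R
  have hT := ht.isTwistTime hH
  refine ⟨max P 0, C, R, le_max_right _ _, hC, fun f F hf h1 h2 => ?_⟩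
  have near : ∀ q θ, f θ + genFun H t θ q ≤ F q + 1 →
      ‖q - θ‖ ≤ R ∧ ‖(flow H t (joinPt H t θ q)).2‖ ≤ max P 0 := by
    intro q θ h
    obtain ⟨w, hw⟩ := h₀ (θ - q)
    have h3 := h1 (θ + intVec w) q
    rw [hf w θ] at h3
    have h4 := hB (θ + intVec w) q (by rw [norm_sub_rev, add_sub_right_comm]; exact hw)
    have h5 := hH.norm_sub_le_chain (hT.chain_genFun hH ht.pos θ q)
    have h6 : ‖q - θ‖ ≤ R := by rw [hR]; linarith
    exact ⟨h6, (hP θ q h6).trans (le_max_left _ _)⟩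
  refine ⟨fun q h => le_of_forall_pos_le_add fun ε hε => ?_, near⟩
  obtain ⟨θ, hθ⟩ := h2 q (min ε 1) (by positivity)
  have h3 := (near q θ (by linarith [min_le_right ε 1])).2
  have h4 := h1 θ (q + h)
  have h5 := (hsc θ q h).1
  have h6 := (real_inner_le_norm (flow H t (joinPt H t θ q)).2 h).trans
    (mul_le_mul_of_nonneg_right h3 (norm_nonneg h))
  linarith [min_le_left ε 1]

theorem abs_sub_le_of_forall_add_le {F : Conf d → ℝ} {P C : ℝ}
    (h : ∀ q h, F (q + h) ≤ F q + P * ‖h‖ + C * ‖h‖ ^ 2) (q q' : Conf d) :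
    |F q' - F q| ≤ P * ‖q' - q‖ + C * ‖q' - q‖ ^ 2 := by
  have h1 := h q (q' - q)
  have h2 := h q' (q - q')
  rw [add_sub_cancel] at h1 h2
  rw [norm_sub_rev q] at h2
  rw [abs_le]
  constructor <;> linarith

theorem continuous_of_forall_add_le {F : Conf d → ℝ} {P C : ℝ}
    (h : ∀ q h, F (q + h) ≤ F q + P * ‖h‖ + C * ‖h‖ ^ 2) : Continuous F := by
  refine continuous_iff_continuousAt.2 fun q => ?_
  rw [ContinuousAt, tendsto_iff_dist_tendsto_zero]
  have h1 : Continuous fun q' : Conf d => P * ‖q' - q‖ + C * ‖q' - q‖ ^ 2 := by fun_prop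
  have h2 := h1.tendsto q
  simp only [sub_self, norm_zero, mul_zero, ne_eq, OfNat.ofNat_ne_zero, not_false_eq_true,
    zero_pow, add_zero] at h2
  exact squeeze_zero (fun _ => dist_nonneg)
    (fun q' => by rw [Real.dist_eq]; exact abs_sub_le_of_forall_add_le h q q') h2

/-! ### Quadratic sub- and superdifferentials. -/

/-- `p` is a superdifferential of `u` at `q`, with a quadratic remainder. -/
def IsSuperDiff (u : Conf d → ℝ) (C : ℝ) (q p : Conf d) : Prop :=
  ∀ h, u (q + h) ≤ u q + ⟪p, h⟫ + C * ‖h‖ ^ 2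

/-- `p` is a subdifferential of `u` at `q`, with a quadratic remainder. -/
def IsSubDiff (u : Conf d → ℝ) (C : ℝ) (q p : Conf d) : Prop :=
  ∀ h, u q + ⟪p, h⟫ - C * ‖h‖ ^ 2 ≤ u (q + h)

theorem IsSuperDiff.eq_of_isSubDiff {u : Conf d → ℝ} {C : ℝ} {q p p' : Conf d} (hC : 0 ≤ C)
    (h : IsSuperDiff u C q p) (h' : IsSubDiff u C q p') : p = p' := by
  -- Along a step `λ (p' - p)` the two bounds give `λ‖p' - p‖² ≤ 2Cλ²‖p' - p‖²`, so any `λ > 0` with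
  -- `2Cλ < 1` would do.
  have h1 := h ((1 / (2 * C + 1)) • (p' - p))
  have h2 := h' ((1 / (2 * C + 1)) • (p' - p))
  have h3 : ⟪p', (1 / (2 * C + 1)) • (p' - p)⟫ - ⟪p, (1 / (2 * C + 1)) • (p' - p)⟫
      = 1 / (2 * C + 1) * ‖p' - p‖ ^ 2 := by
    rw [← inner_sub_left, inner_smul_right, real_inner_self_eq_norm_sq]
  rw [norm_smul, mul_pow, Real.norm_eq_abs, sq_abs] at h1 h2
  have h4 : 1 / (2 * C + 1) * ‖p' - p‖ ^ 2 ≤ 2 * C * ((1 / (2 * C + 1)) ^ 2 * ‖p' - p‖ ^ 2) := by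
    linarith
  have h5 : (2 * C + 1) ^ 2 * (1 / (2 * C + 1) * ‖p' - p‖ ^ 2)
      ≤ (2 * C + 1) ^ 2 * (2 * C * ((1 / (2 * C + 1)) ^ 2 * ‖p' - p‖ ^ 2)) := by gcongr
  have h6 : (2 * C + 1) ^ 2 * (1 / (2 * C + 1) * ‖p' - p‖ ^ 2) = (2 * C + 1) * ‖p' - p‖ ^ 2 := by
    field_simp
  have h7 : (2 * C + 1) ^ 2 * (2 * C * ((1 / (2 * C + 1)) ^ 2 * ‖p' - p‖ ^ 2))
      = 2 * C * ‖p' - p‖ ^ 2 := by field_simp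
  rw [h6, h7] at h5
  have h8 : ‖p' - p‖ = 0 := by nlinarith [norm_nonneg (p' - p)]
  exact (sub_eq_zero.1 (norm_eq_zero.1 h8)).symm

theorem IsSuperDiff.hasGradientAt {u : Conf d → ℝ} {C : ℝ} {q p : Conf d}
    (h : IsSuperDiff u C q p) (h' : IsSubDiff u C q p) : HasGradientAt u p q := by
  rw [hasGradientAt_iff_isLittleO]
  refine Asymptotics.IsBigO.trans_isLittleO (g := fun x => ‖x - q‖ ^ 2) ?_
    (Asymptotics.isLittleO_norm_pow_id one_lt_two |>.comp_tendsto
      (tendsto_sub_nhds_zero_iff.2 Filter.tendsto_id))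
  refine Asymptotics.IsBigO.of_bound C (Filter.Eventually.of_forall fun x => ?_)
  have h1 := h (x - q)
  have h2 := h' (x - q)
  rw [add_sub_cancel] at h1 h2
  rw [Real.norm_eq_abs, norm_pow, norm_norm, abs_le]
  constructor <;> linarith

/-- `u` minus its quadratic upper bound is maximal at `q`, so its derivative vanishes there. -/
theorem IsSuperDiff.eq_gradient {u : Conf d → ℝ} {C : ℝ} {q p : Conf d}
    (h : IsSuperDiff u C q p) (hd : DifferentiableAt ℝ u q) : p = gradient u q := by
  have h1 : HasFDerivAt (fun x : Conf d => u x - ⟪p, x - q⟫ - C * ‖x - q‖ ^ 2)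
      (fderiv ℝ u q - innerSL ℝ p - C • (2 • (innerSL ℝ (q - q)).comp
        (ContinuousLinearMap.id ℝ (Conf d)))) q := by
    have h2 : HasFDerivAt (fun x : Conf d => x - q) (ContinuousLinearMap.id ℝ (Conf d)) q :=
      (hasFDerivAt_id q).sub_const q
    have h3 : HasFDerivAt (fun x : Conf d => ⟪p, x - q⟫) (innerSL ℝ p) q :=
      (innerSL ℝ p).hasFDerivAt.comp q h2
    exact (hd.hasFDerivAt.sub h3).sub (h2.norm_sq.const_mul C)
  have h4 : IsLocalMax (fun x : Conf d => u x - ⟪p, x - q⟫ - C * ‖x - q‖ ^ 2) q := by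
    refine Filter.Eventually.of_forall fun x => ?_
    have := h (x - q)
    rw [add_sub_cancel] at this
    simp only [sub_self, inner_zero_right, norm_zero]
    linarith
  have h5 := h4.hasFDerivAt_eq_zero h1
  rw [sub_self, map_zero, ContinuousLinearMap.zero_comp, smul_zero, smul_zero, sub_zero,
    sub_eq_zero] at h5
  rw [gradient, h5]
  refine ext_inner_right ℝ fun v => ?_
  rw [InnerProductSpace.toDual_symm_apply]
  rfl

theorem norm_sub_le_of_isSuperDiff_isSubDiff {u : Conf d → ℝ} {C : ℝ} {q q' p p' : Conf d}
    (h : IsSuperDiff u C q p) (h₁ : IsSubDiff u C q p) (h' : IsSubDiff u C q' p') (hC : 0 ≤ C) :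
    ‖p' - p‖ ≤ 6 * C * ‖q' - q‖ := by
  rcases eq_or_ne p' p with rfl | hne
  · rw [sub_self, norm_zero]; positivity
  have hpos : 0 < ‖p' - p‖ := norm_pos_iff.2 (sub_ne_zero.2 hne)
  set v := q' - q with hv
  -- The three bounds are compared at `q' + e`, where `e` points along `p' - p` and has the length
  -- of `v`. Since `‖v + e‖² ≤ 4‖v‖²`, the errors add up to `(4 + 1 + 1) C‖v‖²`.
  set e : Conf d := (‖v‖ / ‖p' - p‖) • (p' - p) with he
  have h1 := h (v + e)
  have h2 := h' e
  have h3 := h₁ v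
  have h4 : q + (v + e) = q' + e := by rw [hv]; abel
  have h5 : q + v = q' := by rw [hv]; abel
  rw [h4, inner_add_right] at h1
  rw [h5] at h3
  have h6 : ‖e‖ = ‖v‖ := by
    rw [he, norm_smul, norm_div, norm_norm, norm_norm, div_mul_cancel₀ _ hpos.ne']
  have h7 : ⟪p', e⟫ - ⟪p, e⟫ = ‖v‖ * ‖p' - p‖ := by
    rw [← inner_sub_left, he, inner_smul_right, real_inner_self_eq_norm_sq]
    field_simp
  have h8 : ‖v + e‖ ^ 2 ≤ 4 * ‖v‖ ^ 2 := by
    have := norm_add_le v e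
    rw [h6] at this
    nlinarith [norm_nonneg (v + e), norm_nonneg v]
  have h9 := mul_le_mul_of_nonneg_left h8 hC
  rw [h6] at h2
  have h10 : ‖v‖ * ‖p' - p‖ ≤ 6 * C * ‖v‖ ^ 2 := by linarith
  rcases (norm_nonneg v).eq_or_lt with h0 | h0
  · exfalso
    have hv0 : v = 0 := norm_eq_zero.1 h0.symm
    have hq : q' = q := by rw [← h5, hv0, add_zero]
    subst hq
    exact hne (h.eq_of_isSubDiff hC h').symm
  · rw [sq, ← mul_assoc, mul_comm ‖v‖] at h10
    exact le_of_mul_le_mul_right h10 h0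

/-! ### Minimizing orbits of a weak KAM solution and the structure of `I*(u)`. -/

section WeakKAMSolution

variable {u : Conf d → ℝ} {a t : ℝ}

theorem SmallTime.le_add_genFun (ht : SmallTime H m M t) (hH : Hypotheses H m M)
    (hu : IsWeakKAM H a u) (θ q : Conf d) : u q ≤ u θ + t * a + genFun H t θ q := by
  have := ((hH.isWeakKAM_iff.1 hu) t ht.pos q).1 θ _
    ((ht.isTwistTime hH).chain_genFun hH ht.pos θ q)
  linarith

theorem SmallTime.exists_add_genFun_lt (ht : SmallTime H m M t) (hH : Hypotheses H m M)
    (hu : IsWeakKAM H a u) (q : Conf d) (ε : ℝ) (hε : 0 < ε) :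
    ∃ θ, u θ + t * a + genFun H t θ q < u q + ε := by
  obtain ⟨θ, c, hc, h⟩ := ((hH.isWeakKAM_iff.1 hu) t ht.pos q).2 ε hε
  exact ⟨θ, by linarith [ht.genFun_le_chain hH hc]⟩

theorem PeriodicFunction.add_const (hp : PeriodicFunction u) (c : ℝ) :
    PeriodicFunction fun q => u q + c := fun w q => by simp only [hp w q]

theorem SmallTime.exists_weakKAM_regular (ht : SmallTime H m M t) (hH : Hypotheses H m M)
    (hper : PeriodicHamiltonian H) (hp : PeriodicFunction u) (hu : IsWeakKAM H a u) :
    ∃ P C R : ℝ, (∀ q h, u (q + h) ≤ u q + P * ‖h‖ + C * ‖h‖ ^ 2) ∧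
      ∀ q θ, u θ + t * a + genFun H t θ q ≤ u q + 1 →
        ‖q - θ‖ ≤ R ∧ ‖(flow H t (joinPt H t θ q)).2‖ ≤ P := by
  obtain ⟨P, C, R, -, -, h⟩ := ht.exists_infConv_regular hH hper
  exact ⟨P, C, R, h _ u (hp.add_const (t * a)) (ht.le_add_genFun hH hu)
    (ht.exists_add_genFun_lt hH hu)⟩

theorem IsWeakKAM.continuous (hu : IsWeakKAM H a u) (hp : PeriodicFunction u)
    (hH : Hypotheses H m M) (hper : PeriodicHamiltonian H) : Continuous u := by
  obtain ⟨t, ht⟩ := hH.exists_smallTime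
  obtain ⟨P, C, R, h, -⟩ := ht.exists_weakKAM_regular hH hper hp hu
  exact continuous_of_forall_add_le h

theorem SmallTime.exists_minimizer (ht : SmallTime H m M t) (hH : Hypotheses H m M)
    (hper : PeriodicHamiltonian H) (hp : PeriodicFunction u) (hu : IsWeakKAM H a u) (q : Conf d) :
    ∃ θ, u q = u θ + t * a + genFun H t θ q := by
  obtain ⟨P, C, R, -, h1⟩ := ht.exists_weakKAM_regular hH hper hp hu
  have hgen := (ht.continuous_genFun hH).comp (Continuous.prodMk_left q)
  have hc : Continuous fun θ : Conf d => u θ + t * a + genFun H t θ q :=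
    ((hu.continuous hp hH hper).add continuous_const).add hgen
  obtain ⟨θ₀, hθ₀⟩ := ht.exists_add_genFun_lt hH hu q 1 one_pos
  have mem : ∀ θ, u θ + t * a + genFun H t θ q ≤ u q + 1 → θ ∈ Metric.closedBall q R := by
    intro θ hθ
    rw [Metric.mem_closedBall, dist_comm, dist_eq_norm]
    exact (h1 q θ hθ).1
  obtain ⟨θ, -, hmin⟩ := (isCompact_closedBall q R).exists_isMinOn ⟨θ₀, mem θ₀ hθ₀.le⟩
    hc.continuousOn
  refine ⟨θ, le_antisymm (ht.le_add_genFun hH hu θ q) (le_of_forall_pos_le_add fun ε hε => ?_)⟩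
  obtain ⟨θ', hθ'⟩ := ht.exists_add_genFun_lt hH hu q (min ε 1) (lt_min hε one_pos)
  have h2 := isMinOn_iff.1 hmin θ' (mem θ' (by linarith [min_le_right ε 1]))
  linarith [min_le_left ε 1]

/-- With `θ` fixed, `u` lies below `u θ + t * a + genFun H t θ ·` and touches it at `q`, so it
inherits the upper bound of the generating function. -/
theorem SmallTime.isSuperDiff_of_minimizer (ht : SmallTime H m M t) (hH : Hypotheses H m M)
    (hu : IsWeakKAM H a u) {C : ℝ}
    (hC : ∀ a b h : Conf d,
      genFun H t a (b + h) ≤ genFun H t a b + ⟪(flow H t (joinPt H t a b)).2, h⟫ + C * ‖h‖ ^ 2)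
    {q θ : Conf d} (h : u q = u θ + t * a + genFun H t θ q) :
    IsSuperDiff u C q (flow H t (joinPt H t θ q)).2 := fun k => by
  have h1 := ht.le_add_genFun hH hu θ (q + k)
  have h2 := hC θ q k
  linarith

/-- With `q` fixed instead, `u` lies above `u q - t * a - genFun H t · q` and touches it at `θ`: an
upper bound for the generating function becomes a lower bound for `u`. -/
theorem SmallTime.isSubDiff_of_minimizer (ht : SmallTime H m M t) (hH : Hypotheses H m M)
    (hu : IsWeakKAM H a u) {C : ℝ}
    (hC : ∀ a b h : Conf d,
      genFun H t (a + h) b ≤ genFun H t a b - ⟪(joinPt H t a b).2, h⟫ + C * ‖h‖ ^ 2)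
    {q θ : Conf d} (h : u q = u θ + t * a + genFun H t θ q) :
    IsSubDiff u C θ (joinPt H t θ q).2 := fun k => by
  have h1 := ht.le_add_genFun hH hu (θ + k) q
  have h2 := hC θ q k
  linarith

theorem SmallTime.flow_joinPt_eq (ht : SmallTime H m M t) (hH : Hypotheses H m M) {x : Phase d}
    {θ : Conf d} (h : x.2 = (flow H t (joinPt H t θ x.1)).2) :
    joinPt H t θ x.1 = flow H (-t) x := by
  have : flow H t (joinPt H t θ x.1) = x :=
    Prod.ext ((ht.isTwistTime hH).flow_joinPt ht.pos _ _) h.symm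
  rw [← this, hH.flow_neg_flow]
  rw [this]

theorem SmallTime.exists_minimizer_of_mem_diffGraph (ht : SmallTime H m M t)
    (hH : Hypotheses H m M) (hper : PeriodicHamiltonian H) (hp : PeriodicFunction u)
    (hu : IsWeakKAM H a u) {x : Phase d} (hx : x ∈ diffGraph u) :
    ∃ θ, u x.1 = u θ + t * a + genFun H t θ x.1 ∧ x.2 = (flow H t (joinPt H t θ x.1)).2 := by
  obtain ⟨C, hC, hsc⟩ := ht.exists_genFun_semiconcave hH
  obtain ⟨θ, hθ⟩ := ht.exists_minimizer hH hper hp hu x.1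
  exact ⟨θ, hθ, hx.2.trans ((ht.isSuperDiff_of_minimizer hH hu (fun a b h => (hsc a b h).1)
    hθ).eq_gradient hx.1).symm⟩

/-- The identity is a closed condition on `x`. On `Γ_u` it holds because differentiability forces
the minimizing orbit to arrive with momentum `du`, so that this orbit is the backward orbit of `x`.
-/
theorem SmallTime.calibrated (ht : SmallTime H m M t) (hH : Hypotheses H m M)
    (hper : PeriodicHamiltonian H) (hp : PeriodicFunction u) (hu : IsWeakKAM H a u) {x : Phase d}
    (hx : x ∈ closure (diffGraph u)) :
    u x.1 = u (flow H (-t) x).1 + t * a + act H t (flow H (-t) x) := by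
  have hc := hu.continuous hp hH hper
  have hf := hH.continuous_flow_map (-t)
  have hcl : IsClosed {x : Phase d | u x.1 = u (flow H (-t) x).1 + t * a + act H t (flow H (-t) x)} :=
    isClosed_eq (hc.comp continuous_fst)
      (((hc.comp hf.fst).add continuous_const).add ((hH.continuous_act t).comp hf))
  refine closure_minimal (fun y hy => ?_) hcl hx
  obtain ⟨θ, hθ, hθ'⟩ := ht.exists_minimizer_of_mem_diffGraph hH hper hp hu hy
  have h1 := ht.flow_joinPt_eq hH hθ'
  rw [Set.mem_ofPred_eq, ← h1, ← hH.genFun_eq]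
  exact hθ

/-- Calibration makes the orbit from `φ^{-t} x` minimizing, which gives the subdifferential. Another
minimizing orbit ends at the same position and gives a superdifferential; the two must coincide. `C`
does not depend on `x`. -/
theorem SmallTime.exists_isSuperDiff_isSubDiff (ht : SmallTime H m M t) (hH : Hypotheses H m M)
    (hper : PeriodicHamiltonian H) (hp : PeriodicFunction u) (hu : IsWeakKAM H a u) :
    ∃ C : ℝ, 0 ≤ C ∧ ∀ x ∈ closure (diffGraph u),
      IsSuperDiff u C (flow H (-t) x).1 (flow H (-t) x).2 ∧
      IsSubDiff u C (flow H (-t) x).1 (flow H (-t) x).2 := by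
  obtain ⟨C, hC, hsc⟩ := ht.exists_genFun_semiconcave hH
  refine ⟨C, hC, fun x hx => ?_⟩
  have h1 := ht.calibrated hH hper hp hu hx
  have h2 := (ht.isTwistTime hH).eq_joinPt ht.pos (flow H (-t) x)
  rw [hH.flow_flow_neg] at h2
  have h3 : u x.1 = u (flow H (-t) x).1 + t * a + genFun H t (flow H (-t) x).1 x.1 := by
    rw [hH.genFun_eq, h2]; exact h1
  have h4 := ht.isSubDiff_of_minimizer hH hu (fun a b h => (hsc a b h).2) h3
  rw [h2] at h4
  obtain ⟨θ, hθ⟩ := ht.exists_minimizer hH hper hp hu (flow H (-t) x).1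
  have h5 := ht.isSuperDiff_of_minimizer hH hu (fun a b h => (hsc a b h).1) hθ
  have h4' : IsSubDiff u C (flow H (-t) x).1 (flow H (-t) x).2 := h4
  rw [h5.eq_of_isSubDiff hC h4'] at h5
  exact ⟨h5, h4'⟩

/-- For small times `φ^{-t}` even sends the closure into `Γ_u`, as `u` is differentiable at the
image; longer times are split into small steps. -/
theorem IsWeakKAM.flow_neg_mem_closure (hu : IsWeakKAM H a u) (hp : PeriodicFunction u)
    (hH : Hypotheses H m M) (hper : PeriodicHamiltonian H) {s : ℝ} (hs : 0 ≤ s) {x : Phase d}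
    (hx : x ∈ closure (diffGraph u)) : flow H (-s) x ∈ closure (diffGraph u) := by
  have small : ∀ t, SmallTime H m M t → ∀ x ∈ closure (diffGraph u),
      flow H (-t) x ∈ closure (diffGraph u) := by
    intro t ht x hx
    obtain ⟨C, -, h⟩ := ht.exists_isSuperDiff_isSubDiff hH hper hp hu
    have h1 := (h x hx).1.hasGradientAt (h x hx).2
    exact subset_closure ⟨h1.differentiableAt, h1.gradient.symm⟩
  rcases hs.eq_or_lt with rfl | hs
  · rwa [neg_zero, hH.flow_zero]
  obtain ⟨τ, hτ⟩ := hH.exists_smallTime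
  obtain ⟨n, hn⟩ := exists_nat_gt (s / τ)
  have hn0 : (0 : ℝ) < n := lt_trans (div_pos hs hτ.pos) hn
  have ht : SmallTime H m M (s / n) := by
    refine hτ.mono hH (by positivity) ?_
    rw [div_lt_iff₀ hτ.pos] at hn
    rw [div_le_iff₀ hn0]
    linarith
  have key : ∀ k : ℕ, flow H (-(k * (s / n))) x ∈ closure (diffGraph u) := by
    intro k
    induction k with
    | zero => simpa [hH.flow_zero] using hx
    | succ k ih =>
      have := small _ ht _ ih
      rw [← hH.flow_add] at this
      convert this using 2
      push_cast
      ring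
  have := key n
  rwa [mul_div_cancel₀ _ hn0.ne'] at this

theorem IsWeakKAM.mem_invSet_iff (hu : IsWeakKAM H a u) (hp : PeriodicFunction u)
    (hH : Hypotheses H m M) (hper : PeriodicHamiltonian H) {x : Phase d} :
    x ∈ invSet H u ↔ ∀ s : ℝ, flow H s x ∈ closure (diffGraph u) := by
  simp only [invSet, Set.mem_iInter]
  constructor
  · intro h s
    obtain ⟨n, hn⟩ := exists_nat_ge s
    obtain ⟨y, hy, rfl⟩ := h n
    have := hu.flow_neg_mem_closure hp hH hper (sub_nonneg.2 hn) hy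
    rwa [← hH.flow_add, show -(n : ℝ) + s = -(n - s) by ring]
  · intro h n
    exact ⟨flow H n x, h n, hH.flow_neg_flow _ _⟩

theorem phaseTranslate_mem_diffGraph (hp : PeriodicFunction u) (w : Fin d → ℤ) {x : Phase d}
    (hx : x ∈ diffGraph u) : phaseTranslate w x ∈ diffGraph u := by
  have h1 : (fun q => u (q + intVec w)) = u := funext (hp w)
  have h2 : DifferentiableAt ℝ u (x.1 + intVec w) := by
    rw [← differentiableAt_comp_add_right, h1]; exact hx.1
  refine ⟨h2, hx.2.trans ?_⟩
  change gradient u x.1 = gradient u (x.1 + intVec w)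
  rw [gradient, gradient, ← fderiv_comp_add_right, h1]

theorem continuous_phaseTranslate (w : Fin d → ℤ) : Continuous (phaseTranslate w) := by
  unfold phaseTranslate; fun_prop

theorem phaseTranslate_mem_closure (hp : PeriodicFunction u) (w : Fin d → ℤ) {x : Phase d}
    (hx : x ∈ closure (diffGraph u)) : phaseTranslate w x ∈ closure (diffGraph u) :=
  map_mem_closure (continuous_phaseTranslate w) hx fun _ => phaseTranslate_mem_diffGraph hp w

theorem phaseTranslate_neg (w : Fin d → ℤ) (x : Phase d) :
    phaseTranslate w (phaseTranslate (-w) x) = x := by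
  have : intVec (-w) = -intVec w := by ext i; simp [intVec]
  simp [phaseTranslate, this]

theorem IsWeakKAM.invSet_nonempty (hu : IsWeakKAM H a u) (hp : PeriodicFunction u)
    (hH : Hypotheses H m M) (hper : PeriodicHamiltonian H) : (invSet H u).Nonempty := by
  obtain ⟨t, ht⟩ := hH.exists_smallTime
  obtain ⟨R₀, -, h₀⟩ := exists_norm_add_intVec_le d
  obtain ⟨P, C, R, -, hreg⟩ := ht.exists_weakKAM_regular hH hper hp hu
  have hbd : closure (diffGraph u) ⊆ {x | ‖x.2‖ ≤ P} := by
    refine closure_minimal (fun x hx => ?_) (isClosed_le continuous_snd.norm continuous_const)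
    obtain ⟨θ, hθ, hθ'⟩ := ht.exists_minimizer_of_mem_diffGraph hH hper hp hu hx
    rw [Set.mem_ofPred_eq, hθ']
    exact (hreg x.1 θ (by linarith)).2
  have hne : (diffGraph u).Nonempty := by
    obtain ⟨C, hC, hsc⟩ := ht.exists_genFun_semiconcave hH
    obtain ⟨θ, hθ⟩ := ht.exists_minimizer hH hper hp hu 0
    -- A second step back makes `θ` both the start and the end of a minimizing orbit, so `u` is
    -- differentiable there.
    obtain ⟨θ', hθ'⟩ := ht.exists_minimizer hH hper hp hu θ
    have h1 := ht.isSubDiff_of_minimizer hH hu (fun a b h => (hsc a b h).2) hθ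
    have h2 := ht.isSuperDiff_of_minimizer hH hu (fun a b h => (hsc a b h).1) hθ'
    rw [h2.eq_of_isSubDiff hC h1] at h2
    have h3 := h2.hasGradientAt h1
    exact ⟨(θ, _), h3.differentiableAt, h3.gradient.symm⟩
  -- Bounding the position replaces the quotient by `ℤ^d`. The sets decrease by backward invariance,
  -- and integer translations bring points of `φ^{-n}(Γ_u)` into them.
  set K : ℕ → Set (Phase d) := fun n => {x | ‖x.1‖ ≤ R₀ ∧ flow H n x ∈ closure (diffGraph u)}
  have hK : ∀ n, IsClosed (K n) := fun n =>
    (isClosed_le continuous_fst.norm continuous_const).inter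
      (isClosed_closure.preimage (hH.continuous_flow_map n))
  have hK0 : K 0 ⊆ Metric.closedBall 0 R₀ ×ˢ Metric.closedBall 0 P := by
    rintro x ⟨h1, h2⟩
    rw [Nat.cast_zero, hH.flow_zero] at h2
    exact ⟨by simpa using h1, by simpa using hbd h2⟩
  obtain ⟨x, hx⟩ := IsCompact.nonempty_iInter_of_sequence_nonempty_isCompact_isClosed K
    (fun n x hx => ⟨hx.1, by
      have := hu.flow_neg_mem_closure hp hH hper zero_le_one hx.2
      rwa [← hH.flow_add, Nat.cast_succ, add_neg_cancel_right] at this⟩)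
    (fun n => by
      obtain ⟨y, hy⟩ := hne
      obtain ⟨w, hw⟩ := h₀ (flow H (-n) y).1
      refine ⟨phaseTranslate w (flow H (-n) y), hw, ?_⟩
      rw [hH.flow_phaseTranslate hper, hH.flow_flow_neg]
      exact phaseTranslate_mem_closure hp w (subset_closure hy))
    (((isCompact_closedBall _ _).prod (isCompact_closedBall _ _)).of_isClosed_subset (hK 0) hK0) hK
  refine ⟨x, Set.mem_iInter.2 fun n => ⟨flow H n x, (Set.mem_iInter.1 hx n).2, ?_⟩⟩
  exact hH.flow_neg_flow _ _

theorem IsWeakKAM.isClosed_invSet (hu : IsWeakKAM H a u) (hp : PeriodicFunction u)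
    (hH : Hypotheses H m M) (hper : PeriodicHamiltonian H) : IsClosed (invSet H u) := by
  have : invSet H u = ⋂ s : ℝ, flow H s ⁻¹' closure (diffGraph u) := by
    ext x
    simp only [hu.mem_invSet_iff hp hH hper, Set.mem_iInter, Set.mem_preimage]
  rw [this]
  exact isClosed_iInter fun s => isClosed_closure.preimage (hH.continuous_flow_map s)

theorem IsWeakKAM.flow_image_invSet (hu : IsWeakKAM H a u) (hp : PeriodicFunction u)
    (hH : Hypotheses H m M) (hper : PeriodicHamiltonian H) (t : ℝ) :
    flow H t '' invSet H u = invSet H u := by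
  have key : ∀ (t : ℝ) (x : Phase d), x ∈ invSet H u → flow H t x ∈ invSet H u := by
    intro t x hx
    rw [hu.mem_invSet_iff hp hH hper] at *
    intro s
    rw [← hH.flow_add]
    exact hx _
  refine Set.Subset.antisymm (Set.image_subset_iff.2 fun x hx => key t x hx) fun x hx => ?_
  exact ⟨_, key (-t) x hx, hH.flow_flow_neg t x⟩

theorem IsWeakKAM.phaseTranslate_image_invSet (hu : IsWeakKAM H a u) (hp : PeriodicFunction u)
    (hH : Hypotheses H m M) (hper : PeriodicHamiltonian H) (w : Fin d → ℤ) :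
    phaseTranslate w '' invSet H u = invSet H u := by
  have key : ∀ (w : Fin d → ℤ) (x : Phase d), x ∈ invSet H u → phaseTranslate w x ∈ invSet H u := by
    intro w x hx
    rw [hu.mem_invSet_iff hp hH hper] at *
    intro s
    rw [hH.flow_phaseTranslate hper]
    exact phaseTranslate_mem_closure hp w (hx s)
  refine Set.Subset.antisymm (Set.image_subset_iff.2 fun x hx => key w x hx) fun x hx => ?_
  exact ⟨_, key (-w) x hx, phaseTranslate_neg w x⟩

theorem IsWeakKAM.exists_lipschitz_graph (hu : IsWeakKAM H a u) (hp : PeriodicFunction u)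
    (hH : Hypotheses H m M) (hper : PeriodicHamiltonian H) :
    ∃ (K : NNReal) (f : Conf d → Conf d), LipschitzWith K f ∧ ∀ x ∈ invSet H u, x.2 = f x.1 := by
  obtain ⟨t, ht⟩ := hH.exists_smallTime
  obtain ⟨C, hC, h⟩ := ht.exists_isSuperDiff_isSubDiff hH hper hp hu
  have h' : ∀ x ∈ invSet H u, IsSuperDiff u C x.1 x.2 ∧ IsSubDiff u C x.1 x.2 := by
    intro x hx
    have := h _ ((hu.mem_invSet_iff hp hH hper).1 hx t)
    -- Each point of `I*(u)` is `φ^{-t}` of a point of the closure, so the uniform constant `C`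
    -- applies on all of `I*(u)`.
    rwa [hH.flow_neg_flow] at this
  have hlip : ∀ x ∈ invSet H u, ∀ y ∈ invSet H u, ‖x.2 - y.2‖ ≤ 6 * C * ‖x.1 - y.1‖ :=
    fun x hx y hy =>
      norm_sub_le_of_isSuperDiff_isSubDiff (h' y hy).1 (h' y hy).2 (h' x hx).2 hC
  have hchoice : ∀ q : Conf d, ∃ p, q ∈ Prod.fst '' invSet H u → (q, p) ∈ invSet H u := by
    intro q
    by_cases hq : q ∈ Prod.fst '' invSet H u
    · obtain ⟨x, hx, rfl⟩ := hq
      exact ⟨x.2, fun _ => hx⟩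
    · exact ⟨0, fun h => absurd h hq⟩
  choose f hf using hchoice
  have hfl : LipschitzOnWith (6 * C).toNNReal f (Prod.fst '' invSet H u) := by
    refine LipschitzOnWith.of_dist_le_mul fun q hq q' hq' => ?_
    rw [dist_eq_norm, dist_eq_norm, Real.coe_toNNReal _ (by positivity)]
    exact hlip (q, f q) (hf q hq) (q', f q') (hf q' hq')
  -- The extension may have a larger Lipschitz constant than `6C`.
  obtain ⟨g, hg, hfg⟩ := hfl.extend_finite_dimension
  refine ⟨_, g, hg, fun x hx => ?_⟩
  have hx1 : x.1 ∈ Prod.fst '' invSet H u := ⟨x, hx, rfl⟩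
  rw [← hfg hx1]
  have := hlip x hx (x.1, f x.1) (hf x.1 hx1)
  rw [sub_self, norm_zero, mul_zero] at this
  exact sub_eq_zero.1 (norm_eq_zero.1 (le_antisymm this (norm_nonneg _)))

end WeakKAMSolution

/-! ### Existence of a periodic weak KAM solution. -/

/-- The uniform lower limit of an equicontinuous family of periodic functions. -/
theorem exists_uniform_liminf {v : ℝ → Conf d → ℝ} {τ P C B : ℝ}
    (hper : ∀ t, τ ≤ t → PeriodicFunction (v t))
    (hreg : ∀ t, τ ≤ t → ∀ q h, v t (q + h) ≤ v t q + P * ‖h‖ + C * ‖h‖ ^ 2)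
    (hlow : ∀ t, τ ≤ t → ∀ q, -B ≤ v t q)
    (hup : ∀ (s : ℝ) q, ∃ t, τ ≤ t ∧ s ≤ t ∧ v t q ≤ B) :
    ∃ u : Conf d → ℝ, PeriodicFunction u ∧
      (∀ q ε s, 0 < ε → ∃ t, τ ≤ t ∧ s ≤ t ∧ v t q < u q + ε) ∧
      ∀ ε, 0 < ε → ∃ s, ∀ t, τ ≤ t → s ≤ t → ∀ q, u q - ε < v t q := by
  set A : ℝ → Conf d → Set ℝ := fun s q => (fun t => v t q) '' {t | τ ≤ t ∧ s ≤ t} with hA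
  have hAne : ∀ s q, (A s q).Nonempty := fun s q =>
    ⟨_, max τ s, ⟨le_max_left _ _, le_max_right _ _⟩, rfl⟩
  have hAb : ∀ s q, BddBelow (A s q) := fun s q =>
    ⟨-B, by rintro _ ⟨t, ht, rfl⟩; exact hlow t ht.1 q⟩
  set w : ℝ → Conf d → ℝ := fun s q => sInf (A s q) with hw
  have hwv : ∀ s t q, τ ≤ t → s ≤ t → w s q ≤ v t q := fun s t q h1 h2 =>
    csInf_le (hAb s q) ⟨t, ⟨h1, h2⟩, rfl⟩
  have hmono : ∀ q, Monotone fun s => w s q := fun q s s' hs =>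
    csInf_le_csInf (hAb s q) (hAne s' q) (Set.image_mono fun t ht => ⟨ht.1, hs.trans ht.2⟩)
  have hwB : ∀ s q, w s q ≤ B := fun s q => by
    obtain ⟨t, h1, h2, h3⟩ := hup s q
    exact (hwv s t q h1 h2).trans h3
  have hbdd : ∀ q, BddAbove (Set.range fun s => w s q) := fun q =>
    ⟨B, by rintro _ ⟨s, rfl⟩; exact hwB s q⟩
  have hwreg : ∀ s q h, w s (q + h) ≤ w s q + P * ‖h‖ + C * ‖h‖ ^ 2 := by
    intro s q h
    have : w s (q + h) - (P * ‖h‖ + C * ‖h‖ ^ 2) ≤ w s q := by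
      refine le_csInf (hAne s q) ?_
      rintro _ ⟨t, ht, rfl⟩
      have h1 := hwv s t (q + h) ht.1 ht.2
      have h2 := hreg t ht.1 q h
      simp only
      linarith
    linarith
  have hwper : ∀ s (z : Fin d → ℤ) q, w s (q + intVec z) = w s q := by
    intro s z q
    simp only [hw, hA]
    congr 1
    exact Set.image_congr fun t ht => hper t ht.1 z q
  set u : Conf d → ℝ := fun q => ⨆ s, w s q with hu
  have hwu : ∀ s q, w s q ≤ u q := fun s q => le_ciSup (hbdd q) s
  have hureg : ∀ q h, u (q + h) ≤ u q + P * ‖h‖ + C * ‖h‖ ^ 2 := fun q h =>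
    ciSup_le fun s => by linarith [hwreg s q h, hwu s q]
  have huper : PeriodicFunction u := fun z q => by simp only [hu, hwper]
  refine ⟨u, huper, fun q ε s hε => ?_, fun ε hε => ?_⟩
  · have h1 : sInf (A s q) < u q + ε := by linarith [hwu s q]
    obtain ⟨_, ⟨t, ht, rfl⟩, h2⟩ := exists_lt_of_csInf_lt (hAne s q) h1
    exact ⟨t, ht.1, ht.2, h2⟩
  · obtain ⟨R₀, -, h₀⟩ := exists_norm_add_intVec_le d
    -- Dini's theorem on a ball meeting every `ℤ^d`-orbit: the increasing continuous functions `w s`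
    -- converge to the continuous function `u`.
    have hunif := Monotone.tendstoUniformlyOn_of_forall_tendsto
      (isCompact_closedBall (0 : Conf d) R₀)
      (fun s => (continuous_of_forall_add_le (hwreg s)).continuousOn) (fun q _ => hmono q)
      (continuous_of_forall_add_le hureg).continuousOn
      (fun q _ => tendsto_atTop_ciSup (hmono q) (hbdd q))
    obtain ⟨s, hs⟩ := (Metric.tendstoUniformlyOn_iff.1 hunif ε hε).exists
    refine ⟨s, fun t h1 h2 q => ?_⟩
    obtain ⟨z, hz⟩ := h₀ q
    have h3 := hs (q + intVec z) (by simpa using hz)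
    rw [huper z q, hwper s z q, Real.dist_eq] at h3
    linarith [(abs_lt.1 h3).2, hwv s t q h1 h2]

/-- A two-sided Fekete lemma: `-a` is the infimum of `(g t + D)/t`, which gives the lower bound at
once. If `g t + t * a` exceeded `D + 1` for all large `t`, superadditivity would make this excess
grow linearly with a fixed rate, against times at which the quotient nearly attains its infimum. -/
theorem exists_slope_of_quasi_additive {g : ℝ → ℝ} {τ D K : ℝ} (hτ : 0 < τ) (hD : 0 ≤ D)
    (hsub : ∀ t s, τ ≤ t → τ ≤ s → g (t + s) ≤ g t + g s + D)
    (hsup : ∀ t s, τ ≤ t → τ ≤ s → g t + g s - D ≤ g (t + s))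
    (hK : ∀ t, τ ≤ t → -(K * t) ≤ g t) :
    ∃ a, (∀ t, τ ≤ t → -D ≤ g t + t * a) ∧
      ∀ n : ℝ, ∃ t, τ ≤ t ∧ n ≤ t ∧ g t + t * a ≤ D + 1 := by
  set S : Set ℝ := (fun t => (g t + D) / t) '' Set.Ici τ with hS
  have hne : S.Nonempty := ⟨_, τ, Set.self_mem_Ici, rfl⟩
  have hb : BddBelow S := by
    refine ⟨-K, ?_⟩
    rintro _ ⟨t, ht, rfl⟩
    have ht0 : 0 < t := hτ.trans_le ht
    rw [le_div_iff₀ ht0]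
    linarith [hK t ht]
  refine ⟨-sInf S, fun t ht => ?_, fun n => ?_⟩
  · have h1 := csInf_le hb ⟨t, ht, rfl⟩
    rw [le_div_iff₀ (hτ.trans_le ht)] at h1
    linarith
  by_contra! hn
  set N := max n τ with hN
  have hNpos : 0 < N := hτ.trans_le (le_max_right _ _)
  obtain ⟨_, ⟨t, ht, rfl⟩, hlt⟩ := exists_lt_of_csInf_lt hne
    (show sInf S < sInf S + 1 / (4 * N) by linarith [show 0 < 1 / (4 * N) by positivity])
  have ht0 : 0 < t := hτ.trans_le ht
  have hmul : ∀ (r : ℝ), τ ≤ r → ∀ k : ℕ, τ ≤ ((k + 1 : ℕ) : ℝ) * r ∧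
      g ((k + 1 : ℕ) * r) + D ≤ (k + 1 : ℕ) * (g r + D) ∧
      (k + 1 : ℕ) * (g r - D) ≤ g ((k + 1 : ℕ) * r) - D := by
    intro r hr k
    induction k with
    | zero => simpa using hr
    | succ k ih =>
      have e : ((k + 1 + 1 : ℕ) : ℝ) * r = (k + 1 : ℕ) * r + r := by push_cast; ring
      have h1 := hsub _ r ih.1 hr
      have h2 := hsup _ r ih.1 hr
      rw [← e] at h1 h2
      have h3 := ih.2.1
      have h4 := ih.2.2
      refine ⟨by rw [e]; linarith [ih.1], ?_, ?_⟩
      · rw [Nat.cast_succ (k + 1), add_mul _ _ (g r + D), one_mul]; push_cast at *; linarith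
      · rw [Nat.cast_succ (k + 1), add_mul _ _ (g r - D), one_mul]; push_cast at *; linarith
  obtain ⟨k, hk⟩ := exists_nat_gt (2 * N / t)
  rw [div_lt_iff₀ ht0] at hk
  set L : ℝ := (k + 1 : ℕ) * t with hL
  have hLN : 2 * N ≤ L := by rw [hL]; push_cast; linarith
  -- `L` is cut into `j + 1` equal pieces of length at least `N`. Each brings an excess greater than
  -- `1`, while the total excess is below `L/(4N) < j + 1`.
  obtain ⟨j, hj⟩ : ∃ j : ℕ, ⌊L / N⌋₊ = j + 1 := Nat.exists_eq_succ_of_ne_zero (by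
    rw [Ne, Nat.floor_eq_zero, not_lt, le_div_iff₀ hNpos]; linarith)
  have hj1 : ((j + 1 : ℕ) : ℝ) * N ≤ L := by
    rw [← hj, ← le_div_iff₀ hNpos]
    exact Nat.floor_le (by positivity)
  have hj2 : L < ((j + 1 : ℕ) + 1) * N := by
    rw [← hj, ← div_lt_iff₀ hNpos]
    exact Nat.lt_floor_add_one _
  have hj0 : (0 : ℝ) < (j + 1 : ℕ) := by positivity
  have hNL : N ≤ L / (j + 1 : ℕ) := by rw [le_div_iff₀ hj0]; linarith
  have e1 := hn (L / (j + 1 : ℕ)) ((le_max_right _ _).trans hNL) ((le_max_left _ _).trans hNL)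
  have e2 := (hmul _ ((le_max_right _ _).trans hNL) j).2.2
  have e3 : ((j + 1 : ℕ) : ℝ) * (L / (j + 1 : ℕ)) = L := by field_simp
  rw [e3] at e2
  have e4 := mul_lt_mul_of_pos_left e1 hj0
  have e5 : ((j + 1 : ℕ) : ℝ) * (g (L / (j + 1 : ℕ)) + L / (j + 1 : ℕ) * -sInf S)
      = (j + 1 : ℕ) * g (L / (j + 1 : ℕ)) - L * sInf S := by
    rw [mul_add, ← mul_assoc, e3]; ring
  rw [e5] at e4
  have e6 := (hmul t ht k).2.1
  rw [div_lt_iff₀ ht0] at hlt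
  have e7 := mul_lt_mul_of_pos_left hlt (show (0 : ℝ) < (k + 1 : ℕ) by positivity)
  have e8 : ((k + 1 : ℕ) : ℝ) * ((sInf S + 1 / (4 * N)) * t) = sInf S * L + L / (4 * N) := by
    rw [hL]; field_simp
  have e9 : L / (4 * N) < (j + 1 : ℕ) := by
    rw [div_lt_iff₀ (by positivity)]
    nlinarith
  rw [e8] at e7
  linarith

/-- The least action of broken orbits of length `t` ending at `q`. -/
noncomputable def minCost (H : Phase d → ℝ) (t : ℝ) (q : Conf d) : ℝ :=
  sInf {c | ∃ θ, Chain H t θ q c}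

theorem Hypotheses.minCost_le (hH : Hypotheses H m M) {t c : ℝ} {θ q : Conf d}
    (h : Chain H t θ q c) : minCost H t q ≤ c := by
  refine csInf_le ⟨-(3 / 2 * M * t), ?_⟩ ⟨θ, h⟩
  rintro c ⟨θ, hc⟩
  linarith [hH.norm_sub_le_chain hc, norm_nonneg (q - θ)]

theorem Hypotheses.exists_chain_to (hH : Hypotheses H m M) {t : ℝ} (ht : 0 ≤ t) (q : Conf d) :
    {c | ∃ θ, Chain H t θ q c}.Nonempty := by
  have := Chain.orbit (H := H) t (flow H (-t) (q, 0)) ht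
  rw [hH.flow_flow_neg] at this
  exact ⟨_, _, this⟩

theorem Hypotheses.neg_le_minCost (hH : Hypotheses H m M) {t : ℝ} (ht : 0 ≤ t) (q : Conf d) :
    -(3 / 2 * M * t) ≤ minCost H t q := by
  refine le_csInf (hH.exists_chain_to ht q) ?_
  rintro c ⟨θ, hc⟩
  linarith [hH.norm_sub_le_chain hc, norm_nonneg (q - θ)]

theorem Hypotheses.exists_chain_lt (hH : Hypotheses H m M) {t : ℝ} (ht : 0 ≤ t) (q : Conf d)
    {ε : ℝ} (hε : 0 < ε) : ∃ θ c, Chain H t θ q c ∧ c < minCost H t q + ε := by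
  obtain ⟨c, ⟨θ, hc⟩, h⟩ := exists_lt_of_csInf_lt (hH.exists_chain_to ht q)
    (show minCost H t q < minCost H t q + ε by linarith)
  exact ⟨θ, c, hc, h⟩

theorem Hypotheses.minCost_add_le (hH : Hypotheses H m M) {t s c : ℝ} (ht : 0 ≤ t)
    {θ q : Conf d} (h : Chain H s θ q c) : minCost H (t + s) q ≤ minCost H t θ + c := by
  refine le_of_forall_pos_le_add fun ε hε => ?_
  obtain ⟨θ', c', h1, h2⟩ := hH.exists_chain_lt ht θ hε
  linarith [hH.minCost_le (h1.append h)]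

theorem Hypotheses.exists_minCost_add_lt (hH : Hypotheses H m M) {t s : ℝ} (ht : 0 ≤ t)
    (hs : 0 ≤ s) (q : Conf d) {ε : ℝ} (hε : 0 < ε) :
    ∃ θ c, Chain H s θ q c ∧ minCost H t θ + c < minCost H (t + s) q + ε := by
  obtain ⟨θ', c', h1, h2⟩ := hH.exists_chain_lt (add_nonneg ht hs) q hε
  obtain ⟨θ, c₁, c₂, h3, h4, rfl⟩ := hH.chain_split h1 ht (by linarith)
  rw [add_sub_cancel_left] at h4
  exact ⟨θ, c₂, h4, by linarith [hH.minCost_le h3]⟩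

theorem Hypotheses.minCost_periodic (hH : Hypotheses H m M) (hper : PeriodicHamiltonian H)
    {t : ℝ} (ht : 0 ≤ t) : PeriodicFunction (minCost H t) := by
  have key : ∀ (w : Fin d → ℤ) (q : Conf d), minCost H t (q + intVec w) ≤ minCost H t q := by
    intro w q
    refine le_csInf (hH.exists_chain_to ht q) ?_
    rintro c ⟨θ, hc⟩
    exact hH.minCost_le (hH.chain_translate hper w hc)
  refine fun w q => le_antisymm (key w q) ?_
  have h1 := key (-w) (q + intVec w)
  have h2 : intVec (-w) = -intVec w := by ext i; simp [intVec]
  rwa [h2, add_neg_cancel_right] at h1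

/-- For `t ≥ τ`, `minCost H t` is the infimal convolution of the periodic function `minCost H (t -
τ)` with the generating function of time `τ`. -/
theorem SmallTime.exists_minCost_regular {τ : ℝ} (hτ : SmallTime H m M τ) (hH : Hypotheses H m M)
    (hper : PeriodicHamiltonian H) : ∃ P C : ℝ, 0 ≤ P ∧ 0 ≤ C ∧ ∀ t, τ ≤ t → ∀ q h,
      minCost H t (q + h) ≤ minCost H t q + P * ‖h‖ + C * ‖h‖ ^ 2 := by
  obtain ⟨P, C, R, hP, hC, h⟩ := hτ.exists_infConv_regular hH hper
  refine ⟨P, C, hP, hC, fun t ht => (h (minCost H (t - τ)) (minCost H t)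
    (hH.minCost_periodic hper (by linarith)) (fun θ q => ?_) fun q ε hε => ?_).1⟩
  · have := hH.minCost_add_le (sub_nonneg.2 ht)
      ((hτ.isTwistTime hH).chain_genFun hH hτ.pos θ q)
    rwa [sub_add_cancel] at this
  · obtain ⟨θ, c, h1, h2⟩ := hH.exists_minCost_add_lt (sub_nonneg.2 ht) hτ.pos.le q hε
    rw [sub_add_cancel] at h2
    exact ⟨θ, by linarith [hτ.genFun_le_chain hH h1]⟩

theorem SmallTime.exists_minCost_osc {τ : ℝ} (hτ : SmallTime H m M τ) (hH : Hypotheses H m M)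
    (hper : PeriodicHamiltonian H) : ∃ D : ℝ, 0 ≤ D ∧ ∀ t, τ ≤ t → ∀ q q',
      minCost H t q ≤ minCost H t q' + D := by
  obtain ⟨P, C, hP, hC, h⟩ := hτ.exists_minCost_regular hH hper
  obtain ⟨R₀, hR₀, h₀⟩ := exists_norm_add_intVec_le d
  refine ⟨P * (2 * R₀) + C * (2 * R₀) ^ 2, by positivity, fun t ht q q' => ?_⟩
  obtain ⟨w, hw⟩ := h₀ q
  obtain ⟨w', hw'⟩ := h₀ q'
  have hp := hH.minCost_periodic hper (hτ.pos.le.trans ht)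
  have h1 := h t ht (q' + intVec w') (q + intVec w - (q' + intVec w'))
  rw [add_sub_cancel, hp, hp] at h1
  have h2 : ‖q + intVec w - (q' + intVec w')‖ ≤ 2 * R₀ := by
    linarith [norm_sub_le (q + intVec w) (q' + intVec w')]
  have h3 := mul_le_mul_of_nonneg_left h2 hP
  have h4 := mul_le_mul_of_nonneg_left (pow_le_pow_left₀ (norm_nonneg _) h2 2) hC
  linarith

theorem Hypotheses.exists_weakKAM (hH : Hypotheses H m M) (hper : PeriodicHamiltonian H) :
    ∃ (u : Conf d → ℝ) (a : ℝ), PeriodicFunction u ∧ IsWeakKAM H a u := by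
  obtain ⟨τ, hτ⟩ := hH.exists_smallTime
  obtain ⟨P, C, -, -, hreg⟩ := hτ.exists_minCost_regular hH hper
  obtain ⟨D, hD, hosc⟩ := hτ.exists_minCost_osc hH hper
  have h0 : ∀ t, τ ≤ t → 0 ≤ t := fun t ht => hτ.pos.le.trans ht
  obtain ⟨a, ha1, ha2⟩ := exists_slope_of_quasi_additive (g := fun t => minCost H t 0)
    (K := 3 / 2 * M) hτ.pos hD
    (fun t s ht hs => by
      refine le_of_forall_pos_le_add fun ε hε => ?_
      obtain ⟨θ, c, h1, h2⟩ := hH.exists_chain_lt (h0 s hs) 0 hε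
      linarith [hH.minCost_add_le (h0 t ht) h1, hosc t ht θ 0])
    (fun t s ht hs => by
      refine le_of_forall_pos_le_add fun ε hε => ?_
      obtain ⟨θ, c, h1, h2⟩ := hH.exists_minCost_add_lt (h0 t ht) (h0 s hs) 0 hε
      linarith [hH.minCost_le h1, hosc t ht 0 θ])
    (fun t ht => hH.neg_le_minCost (h0 t ht) 0)
  obtain ⟨u, hu, hu1, hu2⟩ := exists_uniform_liminf (v := fun t q => minCost H t q + t * a)
    (τ := τ) (P := P) (C := C) (B := 2 * D + 1)
    (fun t ht => (hH.minCost_periodic hper (h0 t ht)).add_const _)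
    (fun t ht q h => by linarith [hreg t ht q h])
    (fun t ht q => by linarith [ha1 t ht, hosc t ht 0 q])
    (fun s q => by
      obtain ⟨t, h1, h2, h3⟩ := ha2 s
      exact ⟨t, h1, h2, by linarith [hosc t h1 q 0]⟩)
  refine ⟨u, a, hu, hH.isWeakKAM_iff.2 fun r hr q => ⟨fun θ c hc => ?_, fun ε hε => ?_⟩⟩
  -- Domination: follow the chain from `θ`, starting at a late time that nearly realizes the lower
  -- limit at `θ`.
  · refine le_of_forall_pos_le_add fun ε hε => ?_
    obtain ⟨s, hs⟩ := hu2 (ε / 2) (by positivity)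
    obtain ⟨t, h1, h2, h3⟩ := hu1 θ (ε / 2) s (by positivity)
    have h4 := hs (t + r) (by linarith) (by linarith) q
    have h5 := hH.minCost_add_le (h0 t h1) hc
    linarith
  -- Attainment: take a late time `t` nearly realizing the lower limit at `q` and a near-optimal
  -- chain over the last `r`. Its start `θ` depends on `t`, so the lower bound on the family must be
  -- uniform in the position.
  · obtain ⟨s, hs⟩ := hu2 (ε / 3) (by positivity)
    obtain ⟨t, h1, h2, h3⟩ := hu1 q (ε / 3) (max s τ + r) (by positivity)
    have h4 : τ ≤ t - r := by linarith [le_max_right s τ]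
    have h5 : s ≤ t - r := by linarith [le_max_left s τ]
    obtain ⟨θ, c, h6, h7⟩ := hH.exists_minCost_add_lt (h0 _ h4) hr.le q
      (show 0 < ε / 3 by positivity)
    rw [sub_add_cancel] at h7
    have h8 := hs _ h4 h5 θ
    exact ⟨θ, c, h6, by linarith⟩

end WeakKAM

open WeakKAM in
theorem mainTheorem1 {d : ℕ} (H : Phase d → ℝ) (m M : ℝ)
    (hH : Hypotheses H m M) (hper : PeriodicHamiltonian H) :
    (∃ (u : Conf d → ℝ) (a : ℝ), PeriodicFunction u ∧ IsWeakKAM H a u) ∧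
    ∀ (u : Conf d → ℝ) (a : ℝ), PeriodicFunction u → IsWeakKAM H a u →
      (invSet H u).Nonempty ∧
      IsClosed (invSet H u) ∧
      (∀ t : ℝ, flow H t '' invSet H u = invSet H u) ∧
      (∀ w : Fin d → ℤ, phaseTranslate w '' invSet H u = invSet H u) ∧
      ∃ (K : NNReal) (f : Conf d → Conf d), LipschitzWith K f ∧
        ∀ x ∈ invSet H u, x.2 = f x.1 := by
  refine ⟨hH.exists_weakKAM hper, fun u a hp hu => ⟨hu.invSet_nonempty hp hH hper,
    hu.isClosed_invSet hp hH hper, hu.flow_image_invSet hp hH hper,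
    hu.phaseTranslate_image_invSet hp hH hper, hu.exists_lipschitz_graph hp hH hper⟩⟩
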